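/- A $\mathfrak{Q}$-structure is a quadruple $\mathcal{Q}=(N,g_N,\mathcal{I},\theta)$, where $\mathcal{I}$ is a connected Lie group which acts smoothly, transitively and effectively by isometries on a connected smooth pseudo-Riemannian manifold $(N,g_N)$, and $\theta$ is a smooth $1$-form on $N$ which is invariant under the action of $\mathcal{I}$. For $t\in\mathbb{R}$ let $$\mathcal{M}_{t,\mathcal{Q}}:=(\mathbb{R}\times N,\ g_{t,\mathcal{Q}}),\qquad g_{t,\mathcal{Q}}:=e^{tx}\left(dx^2+dx\circ\theta+ds_N^2\right),$$ where $x$ is the coordinate on $\mathbb{R}$, $ds_N^2=g_N$ and $dx\circ\theta=dx\otimes\theta+\theta\otimes dx$. One says that $\mathcal{Q}$ is a Riemannian $\mathfrak{Q}$-structure if the tensors $g_{t,\mathcal{Q}}$ are positive definite (equivalently, if $g_N$ is positive definite and $\|\theta\|_{g_N}<1$). Theorem. Let $\mathcal{Q}=(N,g_N,\mathcal{I},\theta)$ be a Riemannian $\mathfrak{Q}$-structure and let $t\in\mathbb{R}$, $t\neq0$. Then the following are equivalent: (1) $\mathcal{M}_{t,\mathcal{Q}}$ is isometric to $\mathcal{M}_{\tilde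 t,\tilde{\mathcal{Q}}}$ for some $\tilde t\in\mathbb{R}$ and some $\mathfrak{Q}$-structure $\tilde{\mathcal{Q}}=(\tilde N,\tilde g_N,\tilde{\mathcal{I}},\tilde\theta)$ with $\tilde\theta=0$; (2) $\theta$ is a Killing $1$-form, i.e. $\theta_{a;b}+\theta_{b;a}=0$ for all $a,b$, where ";" denotes covariant differentiation with respect to the Levi-Civita connection of $(N,g_N)$. Moreover, the implication from (2) to (1) also holds for $t=0$. -/

import Mathlib

open scoped Manifold ContDiff

universe u v

noncomputable section

/-- The model space `ℝⁿ` with its Euclidean structure. -/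
abbrev Eucl (n : ℕ) : Type := EuclideanSpace ℝ (Fin n)

/-! ### Pseudo-Riemannian metrics and 1-forms -/

/-- A smooth pseudo-Riemannian metric on a smooth `n`-manifold `N`. -/
structure PseudoRiemannianMetric (n : ℕ) (N : Type*) [TopologicalSpace N]
    [ChartedSpace (Eucl n) N] [IsManifold (𝓡 n) ∞ N] where
  /-- the bilinear form on each tangent space -/
  val (y : N) : TangentSpace (𝓡 n) y →L[ℝ] TangentSpace (𝓡 n) y →L[ℝ] ℝ
  symm (y : N) (v w : TangentSpace (𝓡 n) y) : val y v w = val y w v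
  nondegenerate (y : N) (v : TangentSpace (𝓡 n) y) (hv : ∀ w, val y v w = 0) : v = 0
  contMDiff : ContMDiff (𝓡 n) ((𝓡 n).prod 𝓘(ℝ, Eucl n →L[ℝ] Eucl n →L[ℝ] ℝ)) ∞
    (fun y ↦ Bundle.TotalSpace.mk' (Eucl n →L[ℝ] Eucl n →L[ℝ] ℝ)
      (E := fun y : N ↦ TangentSpace (𝓡 n) y →L[ℝ] TangentSpace (𝓡 n) y →L[ℝ] ℝ) y (val y))

/-- A smooth 1-form on a smooth `n`-manifold `N`, i.e. a smooth section of the cotangent bundle. -/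
structure SmoothOneForm (n : ℕ) (N : Type*) [TopologicalSpace N]
    [ChartedSpace (Eucl n) N] [IsManifold (𝓡 n) ∞ N] where
  /-- the linear functional on each tangent space -/
  val (y : N) : TangentSpace (𝓡 n) y →L[ℝ] ℝ
  contMDiff : ContMDiff (𝓡 n) ((𝓡 n).prod 𝓘(ℝ, Eucl n →L[ℝ] ℝ)) ∞
    (fun y ↦ Bundle.TotalSpace.mk' (Eucl n →L[ℝ] ℝ)
      (E := fun y : N ↦ TangentSpace (𝓡 n) y →L[ℝ] ℝ) y (val y))

/-! ### Covariant differentiation of 1-forms in local coordinates -/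

section Coordinates

attribute [-instance] TopCat.of.chartedSpace

variable {n : ℕ} {N : Type*} [TopologicalSpace N] [ChartedSpace (Eucl n) N]

/-- The partial derivative `∂_a f` at `u` of a function on (an open subset of) `ℝⁿ`. -/
def coordPartial (a : Fin n) (f : Eucl n → ℝ) (u : Eucl n) : ℝ :=
  fderiv ℝ f u (EuclideanSpace.single a 1)

/-- The coordinate vector field `∂_a` of the chart around `p`, at the point of `N` that has
coordinates `u`. -/
def coordVector (p : N) (u : Eucl n) (a : Fin n) :
    TangentSpace (𝓡 n) ((extChartAt (𝓡 n) p).symm u) :=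
  mfderiv 𝓘(ℝ, Eucl n) (𝓡 n) (extChartAt (𝓡 n) p).symm u (EuclideanSpace.single a (1 : ℝ))

variable [IsManifold (𝓡 n) ∞ N]

/-- The matrix `g_{ab} = g(∂_a, ∂_b)` in the chart around `p`. -/
def PseudoRiemannianMetric.coeff (g : PseudoRiemannianMetric n N) (p : N) (u : Eucl n) :
    Matrix (Fin n) (Fin n) ℝ :=
  Matrix.of fun a b ↦ g.val ((extChartAt (𝓡 n) p).symm u) (coordVector p u a) (coordVector p u b)

/-- The Christoffel symbols of the Levi-Civita connection,
`Γ_{ab}^c = ½ g^{cd} (∂_a g_{bd} + ∂_b g_{ad} - ∂_d g_{ab})`, in the chart around `p`. -/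
def PseudoRiemannianMetric.christoffel (g : PseudoRiemannianMetric n N) (p : N) (u : Eucl n)
    (a b c : Fin n) : ℝ :=
  (1 / 2 : ℝ) * ∑ d : Fin n, (g.coeff p u)⁻¹ c d *
    (coordPartial a (fun z ↦ g.coeff p z b d) u + coordPartial b (fun z ↦ g.coeff p z a d) u
      - coordPartial d (fun z ↦ g.coeff p z a b) u)

/-- The components `θ_a = θ(∂_a)` of a 1-form in the chart around `p`. -/
def SmoothOneForm.coeff (θ : SmoothOneForm n N) (p : N) (u : Eucl n) (a : Fin n) : ℝ :=
  θ.val ((extChartAt (𝓡 n) p).symm u) (coordVector p u a)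

/-- The components `θ_{a;b} = ∂_b θ_a - Γ_{ab}^c θ_c` of the covariant derivative `∇θ` with respect
to the Levi-Civita connection of `g`, in the chart around `p`. -/
def SmoothOneForm.covDeriv (θ : SmoothOneForm n N) (g : PseudoRiemannianMetric n N) (p : N)
    (u : Eucl n) (a b : Fin n) : ℝ :=
  coordPartial b (fun z ↦ θ.coeff p z a) u - ∑ c : Fin n, g.christoffel p u a b c * θ.coeff p u c

/-- `θ` is a Killing 1-form of `(N, g)`: `θ_{a;b} + θ_{b;a} = 0` for all `a, b`, at every point of
every coordinate chart. -/
def SmoothOneForm.IsKilling (θ : SmoothOneForm n N) (g : PseudoRiemannianMetric n N) : Prop :=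
  ∀ p : N, ∀ u ∈ (extChartAt (𝓡 n) p).target, ∀ a b : Fin n,
    θ.covDeriv g p u a b + θ.covDeriv g p u b a = 0

end Coordinates

/-! ### `𝔔`-structures -/

/-- A `𝔔`-structure `(N, g_N, 𝓘, θ)`: a connected Lie group `grp` that acts smoothly, transitively
and effectively by isometries on a connected pseudo-Riemannian manifold `(N, metric)`, together with
a smooth 1-form `θ` on `N` that is invariant under the action. -/
structure QStructure : Type (max (u + 1) (v + 1)) where
  /-- the dimension of `N` -/
  dim : ℕ
  /-- the manifold -/
  N : Type u
  [topN : TopologicalSpace N]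
  [chartedN : ChartedSpace (Eucl dim) N]
  [manifoldN : IsManifold (𝓡 dim) ∞ N]
  [t2N : T2Space N]
  [secondCountableN : SecondCountableTopology N]
  [connectedN : ConnectedSpace N]
  /-- the pseudo-Riemannian metric `g_N` -/
  metric : PseudoRiemannianMetric dim N
  /-- the dimension of the Lie group -/
  dimGrp : ℕ
  /-- the Lie group -/
  grp : Type v
  [groupG : Group grp]
  [topG : TopologicalSpace grp]
  [chartedG : ChartedSpace (Eucl dimGrp) grp]
  [lieG : LieGroup (𝓡 dimGrp) ∞ grp]
  [t2G : T2Space grp]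
  [secondCountableG : SecondCountableTopology grp]
  [connectedG : ConnectedSpace grp]
  [action : MulAction grp N]
  smooth_action : ContMDiffSMul (𝓡 dimGrp) (𝓡 dim) ∞ grp N
  transitive : MulAction.IsPretransitive grp N
  effective : FaithfulSMul grp N
  isometries (a : grp) (y : N) (v w : TangentSpace (𝓡 dim) y) :
    metric.val (a • y) (mfderiv (𝓡 dim) (𝓡 dim) (fun z : N ↦ a • z) y v)
      (mfderiv (𝓡 dim) (𝓡 dim) (fun z : N ↦ a • z) y w) = metric.val y v w
  /-- the invariant 1-form -/
  θ : SmoothOneForm dim N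
  invariant (a : grp) (y : N) (v : TangentSpace (𝓡 dim) y) :
    θ.val (a • y) (mfderiv (𝓡 dim) (𝓡 dim) (fun z : N ↦ a • z) y v) = θ.val y v

namespace QStructure

attribute [instance] topN chartedN manifoldN t2N secondCountableN connectedN groupG topG chartedG
  lieG t2G secondCountableG connectedG action

/-- The model with corners of `M = ℝ × N`. -/
abbrev model (Q : QStructure) :
    ModelWithCorners ℝ (ℝ × Eucl Q.dim) (ModelProd ℝ (Eucl Q.dim)) :=
  𝓘(ℝ, ℝ).prod (𝓡 Q.dim)

/-- The symmetric 2-tensor `g_{t,Q} = e^{tx} (dx² + dx ∘ θ + ds²_N)` on `M = ℝ × N`, where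
`dx ∘ θ = dx ⊗ θ + θ ⊗ dx`; a tangent vector at `(x, y)` is a pair of a number and a tangent vector
of `N` at `y`. -/
def form (Q : QStructure) (t : ℝ) (p : ℝ × Q.N) (v w : TangentSpace Q.model p) : ℝ :=
  let v₁ : ℝ := v.1
  let v₂ : TangentSpace (𝓡 Q.dim) p.2 := v.2
  let w₁ : ℝ := w.1
  let w₂ : TangentSpace (𝓡 Q.dim) p.2 := w.2
  Real.exp (t * p.1) *
    (v₁ * w₁ + (v₁ * Q.θ.val p.2 w₂ + Q.θ.val p.2 v₂ * w₁) + Q.metric.val p.2 v₂ w₂)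

/-- `Q` is a Riemannian `𝔔`-structure: the tensors `g_{t,Q}` are positive definite. -/
def IsRiemannian (Q : QStructure) : Prop :=
  ∀ (t : ℝ) (p : ℝ × Q.N) (v : TangentSpace Q.model p), v ≠ 0 → 0 < Q.form t p v v

/-- `M_{t,Q}` and `M_{t',Q'}` are isometric: there is a diffeomorphism that pulls `g_{t',Q'}` back
to `g_{t,Q}`. -/
def Isometric (Q : QStructure) (t : ℝ) (Q' : QStructure) (t' : ℝ) : Prop :=
  ∃ Φ : (ℝ × Q.N) ≃ₘ^∞⟮Q.model, Q'.model⟯ (ℝ × Q'.N),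
    ∀ (p : ℝ × Q.N) (v w : TangentSpace Q.model p),
      Q'.form t' (Φ p) (mfderiv Q.model Q'.model Φ p v) (mfderiv Q.model Q'.model Φ p w)
        = Q.form t p v w

end QStructure

end

/-! Let `X = θ^♯` be the vector field dual to `θ`. It is invariant under a transitive group, hence
complete and of constant square norm `c`; positivity of `g_{t,Q}` gives `c < 1`.

From (2) to (1): if `θ` is Killing, the flow `φ` of `X` preserves `g_N`; it also preserves `X`,
hence `θ`. Put `α² = 1 - c`. The map `(x, y) ↦ (α x, φ_x y)` sends `(r, v)` to `(α r, r X + dφ_x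
v)`. The square of the second entry is `c r² + 2 r θ(v) + |v|²`, so the mixed terms `dx ∘ θ` appear
and `α² + c = 1` restores `dx²`. With `t' = t / α` the exponential factors agree. This rests on
`contMDiff_flow` and `pullback_flow`.

From (1) to (2): for `t ≠ 0` the metric determines the slices `{x} × N`. Consider the lengths of
curves from a point that leave every compact set. A ray in the `x` direction, along which `e^{tx}`
decays, has finite length, and translation by `s` in `x` rescales all lengths by `e^{ts/2}`. If `θ =
0`, the infimum of these lengths is exactly `(2/|t|) e^{tx/2}`: this function controls how far `x`
can move, and homogeneity makes `N` complete. Hence an isometry onto a metric with `θ̃ = 0` carries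
slices to slices (`height_isometry`). There the `x`-lines are orthogonal to the slices. Pulled back,
they give maps `ψ_s` of `N` with `ψ_0 = id`, with `ψ_s^* g_N` independent of `s`, and with initial
velocity `-k X`, where `k = t'/t`.

Both directions use the first variation formula `hasDerivAt_pullback_metric`: if `φ_0 = id` and the
initial velocity is `k θ^♯`, then `φ_s^* g` has derivative `k (θ_{a;b} + θ_{b;a})` at `s = 0`. -/

section

open Set Filter Topology Metric

/-! ### Smoothness of composition operators on spaces of continuous functions -/

section Composition

variable {K : Type*} [TopologicalSpace K] [CompactSpace K]

/-- Pointwise application of a continuous family of operators to a continuous function. -/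
noncomputable def pointwiseApplyL (E F : Type*) [NormedAddCommGroup E] [NormedSpace ℝ E]
    [NormedAddCommGroup F] [NormedSpace ℝ F] :
    C(K, E →L[ℝ] F) →L[ℝ] C(K, E) →L[ℝ] C(K, F) :=
  LinearMap.mkContinuous₂
    (LinearMap.mk₂ ℝ (fun (A : C(K, E →L[ℝ] F)) (h : C(K, E)) ↦
        (⟨fun t ↦ A t (h t), by fun_prop⟩ : C(K, F)))
      (fun _ _ _ ↦ by ext; simp) (fun _ _ _ ↦ by ext; simp)
      (fun _ _ _ ↦ by ext; simp) (fun _ _ _ ↦ by ext; simp)) 1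
    (fun A h ↦ by
      rw [one_mul, ContinuousMap.norm_le _ (by positivity)]
      intro t
      exact ((A t).le_opNorm _).trans (mul_le_mul (A.norm_coe_le_norm t) (h.norm_coe_le_norm t)
        (norm_nonneg _) ((norm_nonneg _).trans (A.norm_coe_le_norm t))))

/-- Compactness of `K` makes the modulus of continuity of `fderiv ℝ X` uniform along `γ`; the mean
value inequality on balls around `γ t` then gives an error that is `o(‖h‖)` uniformly in `t`. -/
theorem hasFDerivAt_continuousMap_comp {E F : Type*} [NormedAddCommGroup E] [NormedSpace ℝ E]
    [NormedAddCommGroup F] [NormedSpace ℝ F] {X : E → F} (hX : ContDiff ℝ 1 X) (γ : C(K, E)) :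
    HasFDerivAt (fun γ : C(K, E) ↦ ContinuousMap.comp ⟨X, hX.continuous⟩ γ)
      (pointwiseApplyL E F
        (ContinuousMap.comp ⟨fderiv ℝ X, hX.continuous_fderiv one_ne_zero⟩ γ)) γ := by
  rw [hasFDerivAt_iff_isLittleO_nhds_zero, Asymptotics.isLittleO_iff]
  intro c hc
  have hcont := hX.continuous_fderiv one_ne_zero
  have key : ∀ᶠ v in 𝓝 (0 : E), ∀ t ∈ (univ : Set K),
      ‖fderiv ℝ X (γ t + v) - fderiv ℝ X (γ t)‖ < c := by
    refine isCompact_univ.eventually_forall_of_forall_eventually fun t _ ↦ ?_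
    have h : ContinuousAt
        (fun p : E × K ↦ ‖fderiv ℝ X (γ p.2 + p.1) - fderiv ℝ X (γ p.2)‖) (0, t) := by
      fun_prop
    exact h.eventually_lt continuousAt_const (by simpa using hc)
  obtain ⟨δ, hδ, hball⟩ := Metric.eventually_nhds_iff_ball.1 key
  filter_upwards [Metric.ball_mem_nhds (0 : C(K, E)) hδ] with h hh
  rw [ContinuousMap.norm_le _ (by positivity)]
  intro t
  have hht : h t ∈ ball (0 : E) δ := by
    rw [mem_ball_zero_iff] at hh ⊢
    exact (h.norm_coe_le_norm t).trans_lt hh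
  have := (convex_ball (γ t) δ).norm_image_sub_le_of_norm_fderiv_le' (f := X) (𝕜 := ℝ)
    (φ := fderiv ℝ X (γ t)) (C := c) (x := γ t) (y := γ t + h t)
    (fun x _ ↦ hX.differentiable one_ne_zero x)
    (fun x hx ↦ by
      have hx' : x - γ t ∈ ball (0 : E) δ := by
        rwa [mem_ball_zero_iff, ← mem_ball_iff_norm]
      simpa using (hball _ hx' t (mem_univ t)).le)
    (mem_ball_self hδ)
    (by rw [mem_ball_iff_norm, add_sub_cancel_left]; rwa [mem_ball_zero_iff] at hht)
  rw [add_sub_cancel_left] at this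
  exact this.trans (mul_le_mul_of_nonneg_left (h.norm_coe_le_norm t) hc.le)

/-- The derivative is the composition operator of `fderiv ℝ X` followed by a bounded linear map, so
induction applies. The target `F` has to vary, since `fderiv ℝ X` takes values in `E →L[ℝ] F`; a
common universe keeps that space admissible. -/
theorem contDiff_nat_continuousMap_comp {E : Type u} [NormedAddCommGroup E] [NormedSpace ℝ E]
    (n : ℕ) : ∀ {F : Type u} [NormedAddCommGroup F] [NormedSpace ℝ F] {X : E → F}
      (hX : ContDiff ℝ n X),
      ContDiff ℝ n (fun γ : C(K, E) ↦ ContinuousMap.comp ⟨X, hX.continuous⟩ γ) := by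
  induction n with
  | zero =>
    intro F _ _ X hX
    exact contDiff_zero.2 (ContinuousMap.continuous_postcomp _)
  | succ n ih =>
    intro F _ _ X hX
    have h1 : ContDiff ℝ 1 X := hX.of_le (by norm_cast; omega)
    push_cast
    rw [contDiff_succ_iff_hasFDerivAt]
    refine ⟨_, ?_, hasFDerivAt_continuousMap_comp h1⟩
    have h2 : ContDiff ℝ n (fderiv ℝ X) := hX.fderiv_right (by norm_cast)
    exact (pointwiseApplyL E F).contDiff.comp (ih h2)

theorem contDiff_continuousMap_comp {E : Type u} [NormedAddCommGroup E] [NormedSpace ℝ E]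
    {X : E → E} (hX : ContDiff ℝ ∞ X) :
    ContDiff ℝ ∞ (fun γ : C(K, E) ↦ ContinuousMap.comp ⟨X, hX.continuous⟩ γ) :=
  contDiff_infty.2 fun n ↦ contDiff_nat_continuousMap_comp n (hX.of_le (by exact_mod_cast le_top))

end Composition

/-! ### Smooth dependence of the flow of a vector field on the initial value -/

section Flow

variable {E : Type u} [NormedAddCommGroup E] [NormedSpace ℝ E]

/-- The operator `f ↦ (t ↦ ∫ s in 0..t, f s)` on continuous functions on `[0, 1]`. -/
noncomputable def primitiveL (E : Type*) [NormedAddCommGroup E] [NormedSpace ℝ E] :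
    C(Icc (0 : ℝ) 1, E) →L[ℝ] C(Icc (0 : ℝ) 1, E) :=
  LinearMap.mkContinuous
    { toFun := fun f ↦ ⟨fun t ↦ ∫ s in (0 : ℝ)..t, IccExtend zero_le_one f s,
        (intervalIntegral.continuous_primitive
          (fun _ _ ↦ (f.continuous.Icc_extend' (h := zero_le_one)).intervalIntegrable _ _) 0).comp
          continuous_subtype_val⟩
      map_add' := fun f g ↦ by
        ext t
        exact intervalIntegral.integral_add
          ((f.continuous.Icc_extend' (h := zero_le_one)).intervalIntegrable _ _)
          ((g.continuous.Icc_extend' (h := zero_le_one)).intervalIntegrable _ _)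
      map_smul' := fun c f ↦ by
        ext t
        exact intervalIntegral.integral_smul c _ } 1
    (fun f ↦ by
      rw [one_mul, ContinuousMap.norm_le _ (by positivity)]
      intro t
      refine (intervalIntegral.norm_integral_le_of_norm_le_const (C := ‖f‖)
        (fun s _ ↦ f.norm_coe_le_norm _)).trans ?_
      rw [sub_zero, abs_of_nonneg t.2.1]
      exact mul_le_of_le_one_right (norm_nonneg _) t.2.2)

theorem primitiveL_apply (f : C(Icc (0 : ℝ) 1, E)) (t : Icc (0 : ℝ) 1) :
    primitiveL E f t = ∫ s in (0 : ℝ)..t, IccExtend zero_le_one f s := rfl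

/-- Rescaling time to `[0, 1]` turns the trajectory up to time `l` into a solution `γ` of `γ = y + l
∫ X(γ)`, with `l` and `y` as parameters. The implicit function theorem in `C([0, 1], E)` gives
smoothness in `(l, y)` jointly. -/
theorem exists_contDiffAt_flow_of_contDiff [CompleteSpace E] {X : E → E} (hX : ContDiff ℝ ∞ X)
    (x₀ : E) :
    ∃ φ : ℝ × E → E, ContDiffAt ℝ ∞ φ (0, x₀) ∧ ∃ ε > 0, ∃ r > 0, ∀ y ∈ ball x₀ r,
      φ (0, y) = y ∧ ∀ s ∈ Ioo (-ε) ε, HasDerivAt (fun s ↦ φ (s, y)) (X (φ (s, y))) s := by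
  obtain ⟨ε, hε, a, r, L, C, hr, hpl⟩ :=
    IsPicardLindelof.of_contDiffAt_one (x₀ := x₀) (hX.of_le (by exact_mod_cast le_top)).contDiffAt
  obtain ⟨α, hα, hαc⟩ := (hpl 0).exists_forall_mem_closedBall_eq_hasDerivWithinAt_continuousOn
  have hr' : (0 : ℝ) < r := hr
  simp only [zero_sub, zero_add] at hα hαc
  have hα0 : ∀ y ∈ ball x₀ r, α (y, 0) = y := fun y hy ↦ (hα y (ball_subset_closedBall hy)).1
  have hαd : ∀ y ∈ ball x₀ r, ∀ s ∈ Ioo (-ε) ε,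
      HasDerivAt (fun s ↦ α (y, s)) (X (α (y, s))) s := fun y hy s hs ↦
    ((hα y (ball_subset_closedBall hy)).2 s (Ioo_subset_Icc_self hs)).hasDerivAt
      (Icc_mem_nhds hs.1 hs.2)
  refine ⟨fun p ↦ α (p.2, p.1), ?_, ε, hε, r, hr', fun y hy ↦ ⟨hα0 y hy, hαd y hy⟩⟩
  let Ω : C(Icc (0 : ℝ) 1, E) → C(Icc (0 : ℝ) 1, E) :=
    fun γ ↦ ContinuousMap.comp ⟨X, hX.continuous⟩ γ
  have hΩ : ContDiff ℝ ∞ Ω := contDiff_continuousMap_comp hX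
  let cst : E →L[ℝ] C(Icc (0 : ℝ) 1, E) := ContinuousLinearMap.const ℝ (Icc (0 : ℝ) 1)
  let F : (ℝ × E) × C(Icc (0 : ℝ) 1, E) → C(Icc (0 : ℝ) 1, E) :=
    fun q ↦ q.2 - cst q.1.2 - q.1.1 • primitiveL E (Ω q.2)
  have hF : ContDiff ℝ ∞ F := by
    refine (contDiff_snd.sub (cst.contDiff.comp (contDiff_snd.comp contDiff_fst))).sub ?_
    exact (contDiff_fst.comp contDiff_fst).smul ((primitiveL E).contDiff.comp (hΩ.comp contDiff_snd))
  set q₀ : (ℝ × E) × C(Icc (0 : ℝ) 1, E) := ((0, x₀), cst x₀) with hq₀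
  have hF0 : F q₀ = 0 := by simp [F, hq₀]
  -- At `l = 0` the integral term disappears and `F` is `γ ↦ γ - x₀`, so the partial derivative in
  -- `γ` is the identity.
  have hpart : fderiv ℝ F q₀ ∘L .inr ℝ (ℝ × E) C(Icc (0 : ℝ) 1, E) = .id ℝ _ := by
    have h1 : HasFDerivAt (fun γ ↦ F ((0, x₀), γ))
        (fderiv ℝ F q₀ ∘L .inr ℝ (ℝ × E) C(Icc (0 : ℝ) 1, E)) (cst x₀) :=
      HasFDerivAt.comp (g := F) (cst x₀) (hF.differentiable (by simp) q₀).hasFDerivAt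
        (hasFDerivAt_prodMk_right _ _)
    have h2 : HasFDerivAt (fun γ ↦ F ((0, x₀), γ)) (.id ℝ _) (cst x₀) := by
      simpa [F] using (hasFDerivAt_id (𝕜 := ℝ) (cst x₀)).sub_const (cst x₀)
    exact h1.unique h2
  have hinv : (fderiv ℝ F q₀ ∘L .inr ℝ (ℝ × E) C(Icc (0 : ℝ) 1, E)).IsInvertible := by
    rw [hpart]; exact ⟨.refl ℝ _, rfl⟩
  have hFa : ContDiffAt ℝ ∞ F q₀ := hF.contDiffAt
  let ψ := hFa.implicitFunction (by simp) hinv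
  have hψ : ContDiffAt ℝ ∞ ψ (0, x₀) := hFa.contDiffAt_implicitFunction (by simp) hinv
  have huniq : ∀ᶠ q in 𝓝 q₀, F q = F q₀ ↔ ψ q.1 = q.2 :=
    hFa.eventually_apply_eq_iff_implicitFunction (by simp) hinv
  obtain ⟨δ, hδ, hδball⟩ := Metric.eventually_nhds_iff_ball.1 huniq
  have hαat : ContinuousAt α (x₀, 0) :=
    hαc.continuousAt (prod_mem_nhds (closedBall_mem_nhds _ hr') (Icc_mem_nhds (by simpa) hε))
  have hclose : ∀ᶠ p in 𝓝 (x₀, (0 : ℝ)), dist (α p) x₀ < δ / 2 := by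
    have := hαat.eventually_mem (ball_mem_nhds _ (half_pos hδ))
    rw [hα0 x₀ (mem_ball_self hr')] at this
    exact this
  obtain ⟨η, hη, hηball⟩ := Metric.eventually_nhds_iff_ball.1 hclose
  -- Near `(0, x₀)` the rescaled Picard–Lindelöf trajectory is a zero of `F` close to the constant
  -- curve, so local uniqueness identifies it with `ψ (l, y)`; its value at time `1` is the flow at
  -- time `l`.
  have hev : (fun p : ℝ × E ↦ α (p.2, p.1)) =ᶠ[𝓝 (0, x₀)] fun p ↦ ψ p ⟨1, by simp⟩ := by
    set ρ : ℝ := min (min ε η) (min r δ) with hρ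
    have hρ0 : 0 < ρ := lt_min (lt_min hε hη) (lt_min hr' hδ)
    filter_upwards [ball_mem_nhds ((0 : ℝ), x₀) hρ0] with p hp
    obtain ⟨l, y⟩ := p
    rw [← ball_prod_same] at hp
    obtain ⟨hl, hy⟩ := hp
    simp only at hl hy
    rw [mem_ball_zero_iff, Real.norm_eq_abs] at hl
    have hyr : y ∈ ball x₀ r := ball_subset_ball ((min_le_right _ _).trans (min_le_left _ _)) hy
    have hlt : ∀ t ∈ Icc (0 : ℝ) 1, |l * t| < ρ := fun t ht ↦ by
      rw [abs_mul, abs_of_nonneg ht.1]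
      exact (mul_le_of_le_one_right (abs_nonneg _) ht.2).trans_lt hl
    have hmem : ∀ t ∈ Icc (0 : ℝ) 1, l * t ∈ Ioo (-ε) ε := fun t ht ↦ by
      rw [mem_Ioo, ← abs_lt]
      exact (hlt t ht).trans_le ((min_le_left _ _).trans (min_le_left _ _))
    have hder : ∀ t ∈ Icc (0 : ℝ) 1,
        HasDerivAt (fun t ↦ α (y, l * t)) (l • X (α (y, l * t))) t := fun t ht ↦ by
      have h := (hαd y hyr (l * t) (hmem t ht)).scomp t ((hasDerivAt_id t).const_mul l)
      simpa [Function.comp_def] using h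
    have hcont : ContinuousOn (fun t ↦ α (y, l * t)) (Icc (0 : ℝ) 1) :=
      fun t ht ↦ (hder t ht).continuousAt.continuousWithinAt
    let γ : C(Icc (0 : ℝ) 1, E) := ⟨fun t ↦ α (y, l * t), hcont.domRestrict⟩
    have hFγ : F ((l, y), γ) = 0 := by
      ext t
      have hsub : uIcc (0 : ℝ) t ⊆ Icc 0 1 := by
        rw [uIcc_of_le t.2.1]; exact Icc_subset_Icc le_rfl t.2.2
      have hint : ∫ s in (0 : ℝ)..t, l • X (α (y, l * s)) = α (y, l * t) - α (y, l * 0) := by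
        refine intervalIntegral.integral_eq_sub_of_hasDerivAt (f := fun t ↦ α (y, l * t))
          (fun s hs ↦ hder s (hsub hs)) ?_
        exact ((hX.continuous.comp_continuousOn hcont).const_smul l |>.mono hsub).intervalIntegrable
      have hcongr : ∫ s in (0 : ℝ)..t, IccExtend zero_le_one (Ω γ) s
          = ∫ s in (0 : ℝ)..t, X (α (y, l * s)) := by
        refine intervalIntegral.integral_congr fun s hs ↦ ?_
        rw [IccExtend_of_mem _ _ (hsub hs)]
        rfl
      rw [mul_zero, hα0 y hyr, intervalIntegral.integral_smul, ← hcongr] at hint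
      change α (y, l * t) - y - l • primitiveL E (Ω γ) t = 0
      rw [primitiveL_apply, hint, sub_self]
    have hγ : ((l, y), γ) ∈ ball q₀ δ := by
      rw [hq₀, ← ball_prod_same]
      refine ⟨?_, ?_⟩
      · rw [← ball_prod_same]
        refine ⟨?_, ball_subset_ball ((min_le_right _ _).trans (min_le_right _ _)) hy⟩
        rw [mem_ball_zero_iff, Real.norm_eq_abs]
        exact hl.trans_le ((min_le_right _ _).trans (min_le_right _ _))
      · rw [mem_ball]
        refine lt_of_le_of_lt ?_ (half_lt_self hδ)
        rw [ContinuousMap.dist_le (half_pos hδ).le]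
        intro t
        refine (hηball (y, l * t) ?_).le
        rw [← ball_prod_same]
        refine ⟨ball_subset_ball ((min_le_left _ _).trans (min_le_right _ _)) hy, ?_⟩
        rw [mem_ball_zero_iff, Real.norm_eq_abs]
        exact (hlt t t.2).trans_le ((min_le_left _ _).trans (min_le_right _ _))
    have := (hδball _ hγ).1 (by rw [hFγ, hF0])
    simp only at this ⊢
    rw [this]
    change α (y, l) = α (y, l * 1)
    rw [mul_one]
  refine ContDiffAt.congr_of_eventuallyEq ?_ hev
  exact (ContinuousMap.evalCLM ℝ (⟨1, by simp⟩ : Icc (0 : ℝ) 1)).contDiff.contDiffAt.comp _ hψ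

/-- The local flow of a smooth vector field is smooth. -/
theorem exists_contDiffAt_flow [FiniteDimensional ℝ E] {X : E → E} {U : Set E} {x₀ : E}
    (hU : U ∈ 𝓝 x₀) (hX : ContDiffOn ℝ ∞ X U) :
    ∃ φ : ℝ × E → E, ContDiffAt ℝ ∞ φ (0, x₀) ∧ ∃ ε > 0, ∃ r > 0, ∀ y ∈ ball x₀ r,
      φ (0, y) = y ∧ ∀ s ∈ Ioo (-ε) ε, HasDerivAt (fun s ↦ φ (s, y)) (X (φ (s, y))) s := by
  have : CompleteSpace E := FiniteDimensional.complete ℝ E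
  obtain ⟨R, hR, hRU⟩ := Metric.nhds_basis_closedBall.mem_iff.1 (interior_mem_nhds.2 hU)
  -- Cutting off makes the field globally smooth. For short times the trajectories stay in the ball
  -- of radius `R / 2`, where `χ = 1`, so they are trajectories of `X` itself.
  let χ : ContDiffBump x₀ := ⟨R / 2, R, half_pos hR, half_lt_self hR⟩
  have hsmooth : ContDiff ℝ ∞ (fun y ↦ χ y • X y) := by
    refine contDiff_iff_contDiffAt.2 fun y ↦ ?_
    by_cases hy : y ∈ closedBall x₀ R
    · exact χ.contDiff.contDiffAt.smul (hX.contDiffAt (mem_interior_iff_mem_nhds.1 (hRU hy)))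
    · refine contDiffAt_const (c := (0 : E)) |>.congr_of_eventuallyEq ?_
      filter_upwards [isClosed_closedBall.isOpen_compl.mem_nhds hy] with z hz
      have : χ z = 0 := χ.zero_of_le_dist (not_le.1 fun h ↦ hz (mem_closedBall.2 h)).le
      rw [this, zero_smul]
  obtain ⟨φ, hφ, ε, hε, r, hr, h⟩ := exists_contDiffAt_flow_of_contDiff hsmooth x₀
  have hφ0 : φ (0, x₀) = x₀ := (h x₀ (mem_ball_self hr)).1
  have hev : ∀ᶠ p in 𝓝 ((0 : ℝ), x₀), φ p ∈ ball x₀ (R / 2) :=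
    hφ.continuousAt.eventually_mem (by rw [hφ0]; exact ball_mem_nhds _ (half_pos hR))
  obtain ⟨η, hη, hηball⟩ := Metric.eventually_nhds_iff_ball.1 hev
  refine ⟨φ, hφ, min ε η, lt_min hε hη, min r η, lt_min hr hη, fun y hy ↦
    ⟨(h y (ball_subset_ball (min_le_left _ _) hy)).1, fun s hs ↦ ?_⟩⟩
  rw [mem_Ioo, ← abs_lt] at hs
  have hd := (h y (ball_subset_ball (min_le_left _ _) hy)).2 s
    (by rw [mem_Ioo, ← abs_lt]; exact hs.trans_le (min_le_left _ _))
  have hmem : φ (s, y) ∈ ball x₀ (R / 2) := hηball (s, y) (by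
    rw [← ball_prod_same]
    refine ⟨?_, ball_subset_ball (min_le_right _ _) hy⟩
    rw [mem_ball_zero_iff, Real.norm_eq_abs]
    exact hs.trans_le (min_le_right _ _))
  rwa [χ.one_of_mem_closedBall (ball_subset_closedBall hmem), one_smul] at hd

end Flow

end

section

open Set Filter Topology Metric Bundle

/-! ### Derivative of the pullback of a bilinear form along a one-parameter family of maps -/

section Euclidean

variable {E : Type*} [NormedAddCommGroup E] [NormedSpace ℝ E]

theorem hasDerivAt_comp_curve {F : Type*} [NormedAddCommGroup F] [NormedSpace ℝ F] {g : E → F}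
    {c : ℝ → E} {V u : E} (hu : c 0 = u) (hg : DifferentiableAt ℝ g u) (h : HasDerivAt c V 0) :
    HasDerivAt (fun s ↦ g (c s)) (fderiv ℝ g u V) 0 := by
  subst hu
  exact HasFDerivAt.comp_hasDerivAt 0 hg.hasFDerivAt h

/-- If `G (s, ·)` is a family of maps with `G (0, ·) = id` whose velocity `V` at `s = 0` is dual to
`k • θ` with respect to `g`, then the derivative of `G (s, ·)^* g` at `s = 0` is the Lie derivative
of `g` along `V`, expressed through the derivatives of `g` and `θ`. -/
theorem hasDerivAt_pullback_bilinear {g : E → E →L[ℝ] E →L[ℝ] ℝ} {θ : E → E →L[ℝ] ℝ}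
    {G : ℝ × E → E} {u : E} {k : ℝ} (hg : DifferentiableAt ℝ g u) (hθ : DifferentiableAt ℝ θ u)
    (hsymm : ∀ᶠ z in 𝓝 u, ∀ v w, g z v w = g z w v)
    (hG : ContDiffAt ℝ 2 G (0, u)) (hG0 : ∀ᶠ z in 𝓝 u, G (0, z) = z)
    (hV : ∀ᶠ z in 𝓝 u, g z (fderiv ℝ G (0, z) (1, 0)) = k • θ z) (v w : E) :
    HasDerivAt (fun s ↦ g (G (s, u)) (fderiv ℝ G (s, u) (0, v)) (fderiv ℝ G (s, u) (0, w)))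
      (k * (fderiv ℝ θ u v w + fderiv ℝ θ u w v)
        + fderiv ℝ g u (fderiv ℝ G (0, u) (1, 0)) v w
        - fderiv ℝ g u v w (fderiv ℝ G (0, u) (1, 0))
        - fderiv ℝ g u w v (fderiv ℝ G (0, u) (1, 0))) 0 := by
  have hG0u : G (0, u) = u := hG0.self_of_nhds
  have hG1 : DifferentiableAt ℝ G (0, u) := hG.differentiableAt (by simp)
  have hG2 : DifferentiableAt ℝ (fderiv ℝ G) (0, u) :=
    (hG.fderiv_right (m := 1) (by norm_num)).differentiableAt (by simp)
  have hid : ∀ x, fderiv ℝ G (0, u) (0, x) = x := fun x ↦ by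
    have h1 : HasFDerivAt (fun z ↦ G (0, z)) (fderiv ℝ G (0, u) ∘L .inr ℝ ℝ E) u :=
      HasFDerivAt.comp (g := G) u hG1.hasFDerivAt (hasFDerivAt_prodMk_right _ _)
    have h2 : HasFDerivAt (fun z ↦ G (0, z)) (.id ℝ E) u :=
      (hasFDerivAt_id u).congr_of_eventuallyEq hG0
    simpa using DFunLike.congr_fun (h1.unique h2) x
  have hline : HasDerivAt (fun s : ℝ ↦ (s, u)) ((1 : ℝ), (0 : E)) 0 :=
    (hasDerivAt_id (0 : ℝ)).prodMk (hasDerivAt_const _ _)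
  set V : E := fderiv ℝ G (0, u) (1, 0) with hVdef
  have hGs : HasDerivAt (fun s ↦ G (s, u)) V 0 := hG1.hasFDerivAt.comp_hasDerivAt _ hline
  have hgs : HasDerivAt (fun s ↦ g (G (s, u))) (fderiv ℝ g u V) 0 := by
    exact hasDerivAt_comp_curve (F := E →L[ℝ] E →L[ℝ] ℝ) hG0u hg hGs
  have hDs : HasDerivAt (fun s ↦ fderiv ℝ G (s, u)) (fderiv ℝ (fderiv ℝ G) (0, u) (1, 0)) 0 :=
    hG2.hasFDerivAt.comp_hasDerivAt _ hline
  have hmain := (hgs.clm_apply (hDs.clm_apply (hasDerivAt_const (0 : ℝ) ((0 : ℝ), v)))).clm_apply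
    (hDs.clm_apply (hasDerivAt_const (0 : ℝ) ((0 : ℝ), w)))
  -- Symmetry of the second derivative exchanges the `s`-derivative of `DG` with the space
  -- derivative of the velocity.
  have hsecond : IsSymmSndFDerivAt ℝ G (0, u) := hG.isSymmSndFDerivAt (by simp)
  have hVz : HasFDerivAt (fun z ↦ fderiv ℝ G (0, z) (1, 0))
      ((ContinuousLinearMap.apply ℝ E ((1 : ℝ), (0 : E))) ∘L
        (fderiv ℝ (fderiv ℝ G) (0, u) ∘L .inr ℝ ℝ E)) u :=
    (ContinuousLinearMap.apply ℝ E ((1 : ℝ), (0 : E))).hasFDerivAt.comp u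
      (HasFDerivAt.comp (g := fderiv ℝ G) u hG2.hasFDerivAt (hasFDerivAt_prodMk_right _ _))
  have hprod := hg.hasFDerivAt.clm_apply hVz
  have hdual := (hθ.hasFDerivAt.const_smul k).congr_of_eventuallyEq hV
  -- Differentiating the duality `g(V, ·) = k θ` in the direction `x` eliminates the derivative of
  -- `V` in favour of derivatives of `g` and `θ`.
  have hrel : ∀ x y, fderiv ℝ g u x V y + g u (fderiv ℝ (fderiv ℝ G) (0, u) (1, 0) (0, x)) y
      = k * fderiv ℝ θ u x y := fun x y ↦ by
    have h := DFunLike.congr_fun (DFunLike.congr_fun (hprod.unique hdual) x) y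
    rw [hsecond.eq]
    simpa [add_comm] using h
  have hDsymm : ∀ x y z, fderiv ℝ g u x y z = fderiv ℝ g u x z y := fun x y z ↦ by
    have h1 := (hg.hasFDerivAt.clm_apply (hasFDerivAt_const y u)).clm_apply (hasFDerivAt_const z u)
    have h2 := (hg.hasFDerivAt.clm_apply (hasFDerivAt_const z u)).clm_apply (hasFDerivAt_const y u)
    have h3 := h2.congr_of_eventuallyEq (hsymm.mono fun p hp ↦ hp y z)
    simpa using DFunLike.congr_fun (h1.unique h3) x
  have hs := hsymm.self_of_nhds
  refine hmain.congr_deriv ?_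
  have e1 := hrel v w
  have e2 := hrel w v
  simp only [hid, hG0u, map_zero, add_zero, add_apply]
  rw [hs v, hDsymm v w V, hDsymm w v V]
  linarith

end Euclidean

/-! ### Metrics and 1-forms in local coordinates -/

section Coordinates

variable {n : ℕ} {N : Type*} [TopologicalSpace N] [ChartedSpace (Eucl n) N]

/-- The linear map `ℝⁿ → T_y N` given by the chart around `p`, where `y` has coordinates `u`. -/
noncomputable def coordFrame (p : N) (u : Eucl n) :
    Eucl n →L[ℝ] TangentSpace (𝓡 n) ((extChartAt (𝓡 n) p).symm u) :=
  mfderiv 𝓘(ℝ, Eucl n) (𝓡 n) (extChartAt (𝓡 n) p).symm u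

variable [IsManifold (𝓡 n) ∞ N]

theorem mdifferentiableAt_extChartAt_symm (p : N) {u : Eucl n}
    (hu : u ∈ (extChartAt (𝓡 n) p).target) :
    MDifferentiableAt 𝓘(ℝ, Eucl n) (𝓡 n) (extChartAt (𝓡 n) p).symm u := by
  have : IsManifold (𝓡 n) 1 N := .of_le (n := ∞) (by simp)
  simpa [mdifferentiableWithinAt_univ] using mdifferentiableWithinAt_extChartAt_symm (I := 𝓡 n) hu

/-- This links chart coordinates with the trivialization of the tangent bundle, through which
smoothness of the metric and of `θ` is expressed. -/
theorem coordFrame_eq_symmL (p : N) {u : Eucl n} (hu : u ∈ (extChartAt (𝓡 n) p).target) :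
    coordFrame p u = (trivializationAt (Eucl n) (TangentSpace (𝓡 n)) p).symmL ℝ
      ((extChartAt (𝓡 n) p).symm u) := by
  have : IsManifold (𝓡 n) 1 N := .of_le (n := ∞) (by simp)
  have h := (extChartAt (𝓡 n) p).map_target hu
  rw [extChartAt_source] at h
  rw [TangentBundle.symmL_trivializationAt h, (extChartAt (𝓡 n) p).right_inv hu]
  rw [show range (𝓡 n) = univ from ModelWithCorners.range_eq_univ _, mfderivWithin_univ]
  rfl

theorem coordFrame_bijective (p : N) {u : Eucl n} (hu : u ∈ (extChartAt (𝓡 n) p).target) :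
    Function.Bijective (coordFrame p u) := by
  have : IsManifold (𝓡 n) 1 N := .of_le (n := ∞) (by simp)
  have := isInvertible_mfderivWithin_extChartAt_symm (I := 𝓡 n) hu
  rw [modelWithCornersSelf_coe, range_id, mfderivWithin_univ] at this
  exact this.bijective

namespace PseudoRiemannianMetric

variable (g : PseudoRiemannianMetric n N)

/-- The metric in the chart around `p`, as a bilinear form on `ℝⁿ`. -/
noncomputable def coord (p : N) (u : Eucl n) : Eucl n →L[ℝ] Eucl n →L[ℝ] ℝ :=
  let B : Eucl n →L[ℝ] Eucl n →L[ℝ] ℝ := g.val ((extChartAt (𝓡 n) p).symm u)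
  let A : Eucl n →L[ℝ] Eucl n := coordFrame p u
  B.bilinearComp A A

theorem coord_symm (p : N) (u v w : Eucl n) : g.coord p u v w = g.coord p u w v :=
  g.symm _ _ _

theorem coeff_eq_coord (p : N) (u : Eucl n) (a b : Fin n) :
    g.coeff p u a b = g.coord p u (EuclideanSpace.single a 1) (EuclideanSpace.single b 1) := rfl

end PseudoRiemannianMetric

/-- A 1-form in the chart around `p`, as a linear form on `ℝⁿ`. -/
noncomputable def SmoothOneForm.coord (θ : SmoothOneForm n N) (p : N) (u : Eucl n) :
    Eucl n →L[ℝ] ℝ :=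
  (θ.val ((extChartAt (𝓡 n) p).symm u)).comp (coordFrame p u)

theorem SmoothOneForm.coeff_eq_coord (θ : SmoothOneForm n N) (p : N) (u : Eucl n) (a : Fin n) :
    θ.coeff p u a = θ.coord p u (EuclideanSpace.single a 1) := rfl

/-- These local sections are constant in the trivialization. Evaluating a smooth tensor on them
yields its smooth coefficient functions. -/
theorem contMDiffOn_trivialization_symm (p : N) (v : Eucl n) :
    ContMDiffOn (𝓡 n) (𝓡 n).tangent ∞
      (fun y : N ↦ (TotalSpace.mk' (Eucl n) y
        ((trivializationAt (Eucl n) (TangentSpace (𝓡 n)) p).symmL ℝ y v) : TangentBundle (𝓡 n) N))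
      (extChartAt (𝓡 n) p).source := by
  have : IsManifold (𝓡 n) (∞ + 1) N := ‹_›
  rw [extChartAt_source, ← TangentBundle.trivializationAt_baseSet (I := 𝓡 n) p]
  rw [Trivialization.contMDiffOn_section_baseSet_iff
    (e := trivializationAt (Eucl n) (TangentSpace (𝓡 n)) p)]
  refine contMDiffOn_const (c := v) |>.congr fun y hy ↦ ?_
  rw [Trivialization.symmL_apply _ hy, Trivialization.apply_mk_symm _ hy]

theorem SmoothOneForm.contDiffOn_coord (θ : SmoothOneForm n N) (p : N) :
    ContDiffOn ℝ ∞ (θ.coord p) (extChartAt (𝓡 n) p).target := by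
  refine contDiffOn_clm_apply.2 fun v ↦ ?_
  rw [← contMDiffOn_iff_contDiffOn]
  have h : ContMDiffOn (𝓡 n) 𝓘(ℝ, ℝ) ∞ (fun y : N ↦ θ.val y
      ((trivializationAt (Eucl n) (TangentSpace (𝓡 n)) p).symmL ℝ y v))
      (extChartAt (𝓡 n) p).source := by
    intro y hy
    have := ContMDiffWithinAt.clm_bundle_apply (θ.contMDiff y).contMDiffWithinAt
      (contMDiffOn_trivialization_symm p v y hy) (E₂ := Trivial N ℝ) (F₂ := ℝ)
    rw [contMDiffWithinAt_section] at this
    exact this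
  refine (h.comp (contMDiffOn_extChartAt_symm p) fun u hu ↦
    (extChartAt (𝓡 n) p).map_target hu).congr fun u hu ↦ ?_
  rw [Function.comp_apply, ← coordFrame_eq_symmL p hu]
  rfl

theorem PseudoRiemannianMetric.contDiffOn_coord (g : PseudoRiemannianMetric n N) (p : N) :
    ContDiffOn ℝ ∞ (g.coord p) (extChartAt (𝓡 n) p).target := by
  refine contDiffOn_clm_apply.2 fun v ↦ contDiffOn_clm_apply.2 fun w ↦ ?_
  rw [← contMDiffOn_iff_contDiffOn]
  have h : ContMDiffOn (𝓡 n) 𝓘(ℝ, ℝ) ∞ (fun y : N ↦ g.val y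
      ((trivializationAt (Eucl n) (TangentSpace (𝓡 n)) p).symmL ℝ y v)
      ((trivializationAt (Eucl n) (TangentSpace (𝓡 n)) p).symmL ℝ y w))
      (extChartAt (𝓡 n) p).source := by
    intro y hy
    have := ContMDiffWithinAt.clm_bundle_apply₂ (g.contMDiff y).contMDiffWithinAt
      (contMDiffOn_trivialization_symm p v y hy)
      (contMDiffOn_trivialization_symm p w y hy) (E₃ := Trivial N ℝ) (F₃ := ℝ)
    rw [contMDiffWithinAt_section] at this
    exact this
  refine (h.comp (contMDiffOn_extChartAt_symm p) fun u hu ↦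
    (extChartAt (𝓡 n) p).map_target hu).congr fun u hu ↦ ?_
  rw [Function.comp_apply, ← coordFrame_eq_symmL p hu]
  rfl

/-! ### The vector field dual to a 1-form -/

theorem isInvertible_of_nondegenerate {E : Type*} [NormedAddCommGroup E] [NormedSpace ℝ E]
    [FiniteDimensional ℝ E] (B : E →L[ℝ] E →L[ℝ] ℝ) (hB : ∀ v, (∀ w, B v w = 0) → v = 0) :
    B.IsInvertible := by
  have hinj : Function.Injective (B : E →ₗ[ℝ] (E →L[ℝ] ℝ)) := by
    rw [injective_iff_map_eq_zero]
    intro v hv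
    exact hB v fun w ↦ by simpa using DFunLike.congr_fun hv w
  have hfin : Module.finrank ℝ E = Module.finrank ℝ (E →L[ℝ] ℝ) := by
    rw [← Subspace.dual_finrank_eq (K := ℝ) (V := E)]
    exact (LinearMap.toContinuousLinearMap (𝕜 := ℝ) (E := E) (F' := ℝ)).finrank_eq
  refine ⟨(LinearEquiv.ofInjectiveOfFinrankEq (B : E →ₗ[ℝ] (E →L[ℝ] ℝ)) hinj
    hfin).toContinuousLinearEquiv, ?_⟩
  ext v w
  rfl

/-- The vector field `θ^♯` dual to the 1-form `θ`. -/
noncomputable def PseudoRiemannianMetric.sharp (g : PseudoRiemannianMetric n N)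
    (θ : SmoothOneForm n N) (y : N) : TangentSpace (𝓡 n) y :=
  (g.val y).inverse (θ.val y)

variable (g : PseudoRiemannianMetric n N) (θ : SmoothOneForm n N)

theorem PseudoRiemannianMetric.val_sharp (y : N) (w : TangentSpace (𝓡 n) y) :
    g.val y (g.sharp θ y) w = θ.val y w := by
  have h : ContinuousLinearMap.IsInvertible (g.val y) :=
    isInvertible_of_nondegenerate (E := Eucl n) (g.val y) (g.nondegenerate y)
  have := h.self_apply_inverse (θ.val y)
  exact DFunLike.congr_fun this w

theorem PseudoRiemannianMetric.eq_of_val_eq {y : N} {v v' : TangentSpace (𝓡 n) y}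
    (h : ∀ w, g.val y v w = g.val y v' w) : v = v' := by
  refine sub_eq_zero.1 (g.nondegenerate y _ fun w ↦ ?_)
  rw [map_sub, sub_apply, h, sub_self]

theorem PseudoRiemannianMetric.coord_nondegenerate (p : N) {u : Eucl n}
    (hu : u ∈ (extChartAt (𝓡 n) p).target) (v : Eucl n) (hv : ∀ w, g.coord p u v w = 0) :
    v = 0 := by
  apply (coordFrame_bijective p hu).1
  rw [map_zero]
  refine g.nondegenerate _ _ fun w ↦ ?_
  obtain ⟨w, rfl⟩ := (coordFrame_bijective p hu).2 w
  exact hv w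

/-- The coordinates of `θ^♯` in the chart around `p`. -/
noncomputable def PseudoRiemannianMetric.coordSharp (p : N) (u : Eucl n) : Eucl n :=
  (g.coord p u).inverse (θ.coord p u)

theorem PseudoRiemannianMetric.coordFrame_coordSharp (p : N) {u : Eucl n}
    (hu : u ∈ (extChartAt (𝓡 n) p).target) :
    coordFrame p u (g.coordSharp θ p u) = g.sharp θ ((extChartAt (𝓡 n) p).symm u) := by
  refine g.eq_of_val_eq fun w ↦ ?_
  obtain ⟨w, rfl⟩ := (coordFrame_bijective p hu).2 w
  rw [g.val_sharp]
  have h := isInvertible_of_nondegenerate _ (g.coord_nondegenerate p hu)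
  exact DFunLike.congr_fun (h.self_apply_inverse (θ.coord p u)) w

theorem PseudoRiemannianMetric.contDiffOn_coordSharp (p : N) :
    ContDiffOn ℝ ∞ (g.coordSharp θ p) (extChartAt (𝓡 n) p).target := by
  intro u hu
  have h := isInvertible_of_nondegenerate _ (g.coord_nondegenerate p hu)
  have h1 : ContDiffWithinAt ℝ ∞ (fun u ↦ (g.coord p u).inverse) (extChartAt (𝓡 n) p).target u :=
    (h.contDiffAt_map_inverse).comp_contDiffWithinAt u (g.contDiffOn_coord p u hu)
  exact h1.clm_apply (θ.contDiffOn_coord p u hu)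

theorem PseudoRiemannianMetric.contMDiff_sharp :
    ContMDiff (𝓡 n) (𝓡 n).tangent ∞
      (fun y : N ↦ (⟨y, g.sharp θ y⟩ : TangentBundle (𝓡 n) N)) := by
  intro p
  have : IsManifold (𝓡 n) (∞ + 1) N := ‹_›
  refine (contMDiffAt_section p).2 ?_
  have hchart : ContMDiffOn (𝓡 n) 𝓘(ℝ, Eucl n) ∞ (extChartAt (𝓡 n) p) (chartAt (Eucl n) p).source :=
    contMDiffOn_extChartAt
  have h := (contMDiffOn_iff_contDiffOn.2 (g.contDiffOn_coordSharp θ p)).comp hchart (fun y hy ↦ by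
      rw [← extChartAt_source (𝓡 n) p] at hy
      exact (extChartAt (𝓡 n) p).map_source hy)
  have hmem := (chartAt (Eucl n) p).open_source.mem_nhds (mem_chart_source _ p)
  refine (h.contMDiffAt hmem).congr_of_eventuallyEq ?_
  filter_upwards [hmem] with y hy
  have hy' : y ∈ (extChartAt (𝓡 n) p).source := by rwa [extChartAt_source]
  have hk := g.coordFrame_coordSharp θ p ((extChartAt (𝓡 n) p).map_source hy')
  rw [coordFrame_eq_symmL p ((extChartAt (𝓡 n) p).map_source hy')] at hk
  rw [(extChartAt (𝓡 n) p).left_inv hy'] at hk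
  rw [← hk]
  have hb : y ∈ (trivializationAt (Eucl n) (TangentSpace (𝓡 n)) p).baseSet := by simpa using hy
  rw [Trivialization.symmL_apply _ hb, Trivialization.apply_mk_symm _ hb]
  rfl

end Coordinates

/-! ### Covariant derivative and first variation of the metric in coordinates. -/

section Coordinates

variable {n : ℕ} {N : Type*} [TopologicalSpace N] [ChartedSpace (Eucl n) N]
  [IsManifold (𝓡 n) ∞ N] (g : PseudoRiemannianMetric n N) (θ : SmoothOneForm n N)

theorem EuclideanSpace.apply_eq_sum (L : Eucl n →L[ℝ] ℝ) (v : Eucl n) :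
    L v = ∑ d, v d * L (EuclideanSpace.single d 1) := by
  have h : v = ∑ d, v d • EuclideanSpace.single d (1 : ℝ) := by
    simpa using ((EuclideanSpace.basisFun (Fin n) ℝ).sum_repr v).symm
  conv_lhs => rw [h]
  simp [map_sum]

/-- The covariant derivative of a 1-form in terms of the derivatives of the coordinate
representations. -/
theorem SmoothOneForm.covDeriv_eq (p : N) {u : Eucl n} (hu : u ∈ (extChartAt (𝓡 n) p).target)
    (a b : Fin n) :
    θ.covDeriv g p u a b =
      fderiv ℝ (θ.coord p) u (EuclideanSpace.single b 1) (EuclideanSpace.single a 1)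
        - 1 / 2 * (fderiv ℝ (g.coord p) u (EuclideanSpace.single a 1)
            (EuclideanSpace.single b 1) (g.coordSharp θ p u)
          + fderiv ℝ (g.coord p) u (EuclideanSpace.single b 1)
            (EuclideanSpace.single a 1) (g.coordSharp θ p u)
          - fderiv ℝ (g.coord p) u (g.coordSharp θ p u)
            (EuclideanSpace.single a 1) (EuclideanSpace.single b 1)) := by
  have hopen : (extChartAt (𝓡 n) p).target ∈ 𝓝 u := (isOpen_extChartAt_target p).mem_nhds hu
  have hθd : DifferentiableAt ℝ (θ.coord p) u :=
    ((θ.contDiffOn_coord p).contDiffAt hopen).differentiableAt (by simp)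
  have hgd : DifferentiableAt ℝ (g.coord p) u :=
    ((g.contDiffOn_coord p).contDiffAt hopen).differentiableAt (by simp)
  set X := g.coordSharp θ p u with hX
  have hθ : ∀ a b, coordPartial b (fun z ↦ θ.coeff p z a) u
      = fderiv ℝ (θ.coord p) u (EuclideanSpace.single b 1) (EuclideanSpace.single a 1) := by
    intro a b
    have h := hθd.hasFDerivAt.clm_apply (hasFDerivAt_const (EuclideanSpace.single a (1 : ℝ)) u)
    simp only [coordPartial, SmoothOneForm.coeff_eq_coord]
    rw [h.fderiv]
    simp
  have hg : ∀ a b c, coordPartial a (fun z ↦ g.coeff p z b c) u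
      = fderiv ℝ (g.coord p) u (EuclideanSpace.single a 1) (EuclideanSpace.single b 1)
        (EuclideanSpace.single c 1) := by
    intro a b c
    have h := (hgd.hasFDerivAt.clm_apply
      (hasFDerivAt_const (EuclideanSpace.single b (1 : ℝ)) u)).clm_apply
      (hasFDerivAt_const (EuclideanSpace.single c (1 : ℝ)) u)
    simp only [coordPartial, PseudoRiemannianMetric.coeff_eq_coord]
    rw [h.fderiv]
    simp
  have hinv := isInvertible_of_nondegenerate _ (g.coord_nondegenerate p hu)
  have hgX : ∀ w, g.coord p u X w = θ.coord p u w :=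
    fun w ↦ DFunLike.congr_fun (hinv.self_apply_inverse (θ.coord p u)) w
  have hmul : ∀ v : Eucl n, (g.coeff p u).mulVec v =
      fun c ↦ g.coord p u v (EuclideanSpace.single c 1) := by
    intro v
    ext c
    rw [g.coord_symm, EuclideanSpace.apply_eq_sum]
    simp [Matrix.mulVec, dotProduct, PseudoRiemannianMetric.coeff_eq_coord, mul_comm]
  have hunit : IsUnit (g.coeff p u) := by
    rw [← Matrix.mulVec_injective_iff_isUnit]
    refine (injective_iff_map_eq_zero (Matrix.mulVecLin (g.coeff p u))).2 fun v hv ↦ ?_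
    have h0 : WithLp.toLp 2 v = (0 : Eucl n) := by
      refine g.coord_nondegenerate p hu _ fun w ↦ ?_
      have := (hmul (WithLp.toLp 2 v)).symm.trans hv
      rw [EuclideanSpace.apply_eq_sum]
      refine Finset.sum_eq_zero fun c _ ↦ ?_
      rw [congr_fun this c]
      simp
    simpa using h0
  have hsymmM : (g.coeff p u)⁻¹.transpose = (g.coeff p u)⁻¹ := by
    rw [Matrix.transpose_nonsing_inv]
    congr 1
    ext a b
    exact g.coord_symm p u _ _
  -- Contracting `θ` with the inverse matrix raises its index. Thus `Γ_{ab}^c θ_c` becomes an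
  -- expression in derivatives of `g` evaluated on `θ^♯`.
  have hXinv : ∀ d, ∑ c, (g.coeff p u)⁻¹ c d * θ.coeff p u c = X d := by
    intro d
    have h1 : (fun c ↦ θ.coeff p u c) = (g.coeff p u).mulVec X := by
      rw [hmul]
      ext c
      rw [hgX, SmoothOneForm.coeff_eq_coord]
    have h2 : (g.coeff p u)⁻¹.mulVec (fun c ↦ θ.coeff p u c) = X := by
      rw [h1, Matrix.mulVec_mulVec, Matrix.nonsing_inv_mul _
        ((Matrix.isUnit_iff_isUnit_det _).1 hunit), Matrix.one_mulVec]
    rw [← congr_fun h2 d, Matrix.mulVec, dotProduct]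
    refine Finset.sum_congr rfl fun c _ ↦ ?_
    rw [← hsymmM, Matrix.transpose_apply, hsymmM]
  have hsum : ∑ c, g.christoffel p u a b c * θ.coeff p u c
      = 1 / 2 * ∑ d, X d * (fderiv ℝ (g.coord p) u (EuclideanSpace.single a 1)
            (EuclideanSpace.single b 1) (EuclideanSpace.single d 1)
          + fderiv ℝ (g.coord p) u (EuclideanSpace.single b 1)
            (EuclideanSpace.single a 1) (EuclideanSpace.single d 1)
          - fderiv ℝ (g.coord p) u (EuclideanSpace.single d 1)
            (EuclideanSpace.single a 1) (EuclideanSpace.single b 1)) := by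
    simp only [PseudoRiemannianMetric.christoffel, hg, ← hXinv, Finset.mul_sum, Finset.sum_mul]
    rw [Finset.sum_comm]
    refine Finset.sum_congr rfl fun d _ ↦ Finset.sum_congr rfl fun c _ ↦ by ring
  have e1 := EuclideanSpace.apply_eq_sum (fderiv ℝ (g.coord p) u (EuclideanSpace.single a 1)
    (EuclideanSpace.single b 1)) X
  have e2 := EuclideanSpace.apply_eq_sum (fderiv ℝ (g.coord p) u (EuclideanSpace.single b 1)
    (EuclideanSpace.single a 1)) X
  have e3 := EuclideanSpace.apply_eq_sum (((fderiv ℝ (g.coord p) u).flip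
    (EuclideanSpace.single a 1)).flip (EuclideanSpace.single b 1)) X
  simp only [ContinuousLinearMap.flip_apply] at e3
  rw [SmoothOneForm.covDeriv, hθ, hsum, e1, e2, e3, ← Finset.sum_add_distrib,
    ← Finset.sum_sub_distrib]
  simp only [mul_add, mul_sub]

/-- Factoring the differential through the coordinate frame moves computations on `N` to `ℝⁿ`. -/
theorem hasMFDerivAt_of_chart {F : Type*} [NormedAddCommGroup F] [NormedSpace ℝ F] {ψ : F → N}
    {q : F} (hψ : MDifferentiableAt 𝓘(ℝ, F) (𝓡 n) ψ q) {p : N}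
    (hq : ψ q ∈ (extChartAt (𝓡 n) p).source) :
    HasMFDerivAt 𝓘(ℝ, F) (𝓡 n) ψ q
      (coordFrame p (extChartAt (𝓡 n) p (ψ q)) ∘L fderiv ℝ (extChartAt (𝓡 n) p ∘ ψ) q) := by
  have : IsManifold (𝓡 n) 1 N := .of_le (n := ∞) (by simp)
  have hchart : MDifferentiableAt 𝓘(ℝ, F) 𝓘(ℝ, Eucl n) (extChartAt (𝓡 n) p ∘ ψ) q :=
    (mdifferentiableAt_extChartAt (by rwa [extChartAt_source] at hq)).comp q hψ
  have h1 : HasMFDerivAt 𝓘(ℝ, F) 𝓘(ℝ, Eucl n) (extChartAt (𝓡 n) p ∘ ψ) q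
      (fderiv ℝ (extChartAt (𝓡 n) p ∘ ψ) q) :=
    (mdifferentiableAt_iff_differentiableAt.1 hchart).hasFDerivAt.hasMFDerivAt
  have h2 := (mdifferentiableAt_extChartAt_symm p
    ((extChartAt (𝓡 n) p).map_source hq)).hasMFDerivAt
  refine (HasMFDerivAt.comp q h2 h1).congr_of_eventuallyEq ?_
  filter_upwards [hψ.continuousAt.eventually_mem
    ((isOpen_extChartAt_source p).mem_nhds hq)] with x hx
  exact ((extChartAt (𝓡 n) p).left_inv hx).symm

theorem PseudoRiemannianMetric.val_eq_coord {p y : N} (hy : y ∈ (extChartAt (𝓡 n) p).source)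
    (v w : Eucl n) :
    g.val y (coordFrame p (extChartAt (𝓡 n) p y) v) (coordFrame p (extChartAt (𝓡 n) p y) w)
      = g.coord p (extChartAt (𝓡 n) p y) v w := by
  -- The round trip through the chart returns `y` only up to a propositional equality, while tangent
  -- spaces depend on the point; vectors are therefore compared in the model space.
  have key : ∀ z : N, z = y → ∀ v' w' : Eucl n,
      (g.val y : Eucl n →L[ℝ] Eucl n →L[ℝ] ℝ) v' w'
        = (g.val z : Eucl n →L[ℝ] Eucl n →L[ℝ] ℝ) v' w' := by
    rintro z rfl v' w'; rfl
  exact key _ ((extChartAt (𝓡 n) p).left_inv hy) _ _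

theorem SmoothOneForm.val_eq_coord {p y : N} (hy : y ∈ (extChartAt (𝓡 n) p).source)
    (v : Eucl n) :
    θ.val y (coordFrame p (extChartAt (𝓡 n) p y) v) = θ.coord p (extChartAt (𝓡 n) p y) v := by
  have key : ∀ z : N, z = y → ∀ v' : Eucl n,
      (θ.val y : Eucl n →L[ℝ] ℝ) v' = (θ.val z : Eucl n →L[ℝ] ℝ) v' := by
    rintro z rfl v'; rfl
  exact key _ ((extChartAt (𝓡 n) p).left_inv hy) _

/-- The derivative at `s = 0` of `φ_s^* g`, where `φ_s` is a family of maps with `φ_0 = id` whose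
velocity at `s = 0` is `k θ^♯`. -/
theorem hasDerivAt_pullback_metric {φ : ℝ × N → N}
    (hφ : ContMDiff (𝓘(ℝ, ℝ).prod (𝓡 n)) (𝓡 n) ∞ φ) (hφ0 : ∀ z, φ (0, z) = z) {k : ℝ}
    (hvel : ∀ (z : N) (w : TangentSpace (𝓡 n) (φ (0, z))),
      g.val (φ (0, z)) (mfderiv 𝓘(ℝ, ℝ) (𝓡 n) (fun s : ℝ ↦ φ (s, z)) 0 (1 : ℝ)) w
        = k * θ.val (φ (0, z)) w)
    (p : N) {u : Eucl n} (hu : u ∈ (extChartAt (𝓡 n) p).target) (a b : Fin n) :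
    HasDerivAt (fun s : ℝ ↦ g.val (φ (s, (extChartAt (𝓡 n) p).symm u))
        (mfderiv (𝓡 n) (𝓡 n) (fun z ↦ φ (s, z)) ((extChartAt (𝓡 n) p).symm u) (coordVector p u a))
        (mfderiv (𝓡 n) (𝓡 n) (fun z ↦ φ (s, z)) ((extChartAt (𝓡 n) p).symm u) (coordVector p u b)))
      (k * (θ.covDeriv g p u a b + θ.covDeriv g p u b a)) 0 := by
  set f := extChartAt (𝓡 n) p with hf
  let ψ : ℝ × Eucl n → N := fun q ↦ φ (q.1, f.symm q.2)
  let G : ℝ × Eucl n → Eucl n := f ∘ ψ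
  have htarget : f.target ∈ 𝓝 u := (isOpen_extChartAt_target p).mem_nhds hu
  have hψ : ∀ q : ℝ × Eucl n, q.2 ∈ f.target →
      ContMDiffAt 𝓘(ℝ, ℝ × Eucl n) (𝓡 n) ∞ ψ q := by
    intro q hq
    refine hφ.contMDiffAt.comp q (contDiffAt_fst.contMDiffAt.prodMk ?_)
    exact ((contMDiffOn_extChartAt_symm p).contMDiffAt
      ((isOpen_extChartAt_target p).mem_nhds hq)).comp q contDiffAt_snd.contMDiffAt
  have hψ0 : ∀ z, ψ (0, z) = f.symm z := fun z ↦ hφ0 _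
  have hG0 : ∀ z ∈ f.target, G (0, z) = z := fun z hz ↦ by
    change f (ψ (0, z)) = z
    rw [hψ0, f.right_inv hz]
  have hG : ContDiffAt ℝ 2 G (0, u) := by
    rw [← contMDiffAt_iff_contDiffAt]
    have h1 : ContMDiffAt (𝓡 n) 𝓘(ℝ, Eucl n) ∞ f (ψ (0, u)) := by
      refine contMDiffAt_extChartAt' ?_
      rw [← extChartAt_source (𝓡 n) p, hψ0]
      exact f.map_target hu
    exact (h1.comp (0, u) (hψ (0, u) hu)).of_le (by norm_cast)
  -- In the chart, `dφ_s` is the space part of the derivative of `G`, so the pulled back metric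
  -- takes the form treated in `hasDerivAt_pullback_bilinear`.
  have hframe : ∀ (s : ℝ) (z : Eucl n), z ∈ f.target → ψ (s, z) ∈ f.source → ∀ v,
      mfderiv (𝓡 n) (𝓡 n) (fun y ↦ φ (s, y)) (f.symm z) (coordFrame p z v)
        = coordFrame p (f (ψ (s, z))) (fderiv ℝ G (s, z) (0, v)) := by
    intro s z hz hs v
    have h1 := hasMFDerivAt_of_chart ((hψ (s, z) hz).mdifferentiableAt (by simp)) hs
    have h2 : HasMFDerivAt 𝓘(ℝ, Eucl n) 𝓘(ℝ, ℝ × Eucl n) (fun y : Eucl n ↦ (s, y)) z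
        (ContinuousLinearMap.inr ℝ ℝ (Eucl n)) :=
      (hasFDerivAt_prodMk_right _ _).hasMFDerivAt
    have h3 := HasMFDerivAt.comp z h1 h2
    have h4 : MDifferentiableAt (𝓡 n) (𝓡 n) (fun y ↦ φ (s, y)) (f.symm z) :=
      (hφ.comp (contMDiff_const.prodMk contMDiff_id)).mdifferentiableAt (by simp)
    have h5 := HasMFDerivAt.comp z h4.hasMFDerivAt
      (mdifferentiableAt_extChartAt_symm p hz).hasMFDerivAt
    exact DFunLike.congr_fun (hasMFDerivAt_unique h5 h3) v
  have hVel : ∀ z ∈ f.target, g.coord p z (fderiv ℝ G (0, z) (1, 0)) = k • θ.coord p z := by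
    intro z hz
    have hs : ψ (0, z) ∈ f.source := by rw [hψ0]; exact f.map_target hz
    have h1 := hasMFDerivAt_of_chart ((hψ (0, z) hz).mdifferentiableAt (by simp)) hs
    have h2 : HasMFDerivAt 𝓘(ℝ, ℝ) 𝓘(ℝ, ℝ × Eucl n) (fun s : ℝ ↦ (s, z)) 0
        (ContinuousLinearMap.inl ℝ ℝ (Eucl n)) :=
      (hasFDerivAt_prodMk_left _ _).hasMFDerivAt
    have h3 : mfderiv 𝓘(ℝ, ℝ) (𝓡 n) (fun s : ℝ ↦ φ (s, f.symm z)) 0 (1 : ℝ)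
        = coordFrame p (f (ψ (0, z))) (fderiv ℝ G (0, z) (1, 0)) :=
      DFunLike.congr_fun (HasMFDerivAt.comp (0 : ℝ) h1 h2).mfderiv (1 : ℝ)
    ext w
    have h4 := hvel (f.symm z) (coordFrame p (f (ψ (0, z))) w)
    have h5 := g.val_eq_coord hs (fderiv ℝ G (0, z) (1, 0)) w
    have h6 := θ.val_eq_coord hs w
    have hfz : f (ψ (0, z)) = z := hG0 z hz
    rw [h3] at h4
    rw [hfz] at h5 h6
    rw [hfz] at h4
    exact h5.symm.trans (h4.trans (congr_arg (k * ·) h6))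
  have hmain := hasDerivAt_pullback_bilinear
    (((g.contDiffOn_coord p).contDiffAt htarget).differentiableAt (by simp))
    (((θ.contDiffOn_coord p).contDiffAt htarget).differentiableAt (by simp))
    (Eventually.of_forall fun z ↦ g.coord_symm p z) hG (mem_of_superset htarget hG0)
    (mem_of_superset htarget hVel) (EuclideanSpace.single a 1) (EuclideanSpace.single b 1)
  have hX : fderiv ℝ G (0, u) (1, 0) = k • g.coordSharp θ p u := by
    have hinv := isInvertible_of_nondegenerate _ (g.coord_nondegenerate p hu)
    apply hinv.bijective.1
    rw [hVel u hu, map_smul]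
    congr 1
    exact (hinv.self_apply_inverse (θ.coord p u)).symm
  have hev : ∀ᶠ s in 𝓝 (0 : ℝ), ψ (s, u) ∈ f.source := by
    have hc : ContinuousAt (fun s : ℝ ↦ ψ (s, u)) 0 :=
      ContinuousAt.comp (f := fun s : ℝ ↦ (s, u)) (hψ (0, u) hu).continuousAt (by fun_prop)
    refine hc.eventually_mem ((isOpen_extChartAt_source p).mem_nhds ?_)
    rw [hψ0]
    exact f.map_target hu
  refine (hmain.congr_of_eventuallyEq ?_).congr_deriv ?_
  · filter_upwards [hev] with s hs
    have h1 := hframe s u hu hs (EuclideanSpace.single a 1)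
    have h2 := hframe s u hu hs (EuclideanSpace.single b 1)
    exact (congr_arg₂ (fun x y ↦ g.val (φ (s, f.symm u)) x y) h1 h2).trans
      (g.val_eq_coord hs _ _)
  · rw [θ.covDeriv_eq g p hu, θ.covDeriv_eq g p hu, hX]
    have hs : ∀ x, fderiv ℝ (g.coord p) u x (EuclideanSpace.single b 1) (EuclideanSpace.single a 1)
        = fderiv ℝ (g.coord p) u x (EuclideanSpace.single a 1) (EuclideanSpace.single b 1) := by
      intro x
      have hd := ((g.contDiffOn_coord p).contDiffAt htarget).differentiableAt (by simp)
      have h1 := (hd.hasFDerivAt.clm_apply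
        (hasFDerivAt_const (EuclideanSpace.single b (1 : ℝ)) u)).clm_apply
        (hasFDerivAt_const (EuclideanSpace.single a (1 : ℝ)) u)
      have h2 := (hd.hasFDerivAt.clm_apply
        (hasFDerivAt_const (EuclideanSpace.single a (1 : ℝ)) u)).clm_apply
        (hasFDerivAt_const (EuclideanSpace.single b (1 : ℝ)) u)
      have h3 := h2.congr_of_eventuallyEq (Eventually.of_forall fun z ↦ g.coord_symm p z _ _)
      simpa using DFunLike.congr_fun (h1.unique h3) x
    have e1 := hs (g.coordSharp θ p u)
    have e2 : fderiv ℝ (g.coord p) u (k • g.coordSharp θ p u) (EuclideanSpace.single a 1)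
        (EuclideanSpace.single b 1) = k * fderiv ℝ (g.coord p) u (g.coordSharp θ p u)
        (EuclideanSpace.single a 1) (EuclideanSpace.single b 1) := by
      rw [(fderiv ℝ (g.coord p) u).map_smul k]
      rfl
    have e3 : ∀ c d, fderiv ℝ (g.coord p) u c d (k • g.coordSharp θ p u)
        = k * fderiv ℝ (g.coord p) u c d (g.coordSharp θ p u) :=
      fun c d ↦ (fderiv ℝ (g.coord p) u c d).map_smul k _
    rw [e2, e3, e3]
    linear_combination (-k / 2) * e1

end Coordinates

/-! ### The local flow of `θ^♯`. -/

section LocalFlow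

variable {n : ℕ} {N : Type*} [TopologicalSpace N] [ChartedSpace (Eucl n) N]
  [IsManifold (𝓡 n) ∞ N] (g : PseudoRiemannianMetric n N) (θ : SmoothOneForm n N)

/-- The vector field dual to a 1-form has a smooth local flow around each point. -/
theorem PseudoRiemannianMetric.exists_local_flow_sharp (o : N) :
    ∃ φ : ℝ × N → N, ContMDiffAt (𝓘(ℝ, ℝ).prod (𝓡 n)) (𝓡 n) ∞ φ (0, o) ∧
      ∃ ε > 0, ∀ᶠ y in 𝓝 o, φ (0, y) = y ∧
        IsMIntegralCurveOn (I := 𝓡 n) (fun s ↦ φ (s, y)) (g.sharp θ) (Ioo (-ε) ε) := by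
  set f := extChartAt (𝓡 n) o with hf
  have ho : o ∈ f.source := mem_extChartAt_source o
  have htarget : f.target ∈ 𝓝 (f o) := extChartAt_target_mem_nhds o
  obtain ⟨φ, hφ, ε, hε, r, hr, hflow⟩ :=
    exists_contDiffAt_flow htarget (g.contDiffOn_coordSharp θ o)
  have hφ0 : φ (0, f o) = f o := (hflow _ (mem_ball_self hr)).1
  have hev : ∀ᶠ q in 𝓝 ((0 : ℝ), f o), φ q ∈ f.target :=
    hφ.continuousAt.eventually_mem (by rwa [hφ0])
  obtain ⟨δ, hδ, hδball⟩ := Metric.eventually_nhds_iff_ball.1 hev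
  refine ⟨fun q ↦ f.symm (φ (q.1, f q.2)), ?_, min ε δ, lt_min hε hδ, ?_⟩
  · have h1 : ContMDiffAt 𝓘(ℝ, Eucl n) (𝓡 n) ∞ f.symm (φ (0, f o)) :=
      (contMDiffOn_extChartAt_symm o).contMDiffAt (by rwa [hφ0])
    have h2 : ContMDiffAt (𝓡 n) 𝓘(ℝ, Eucl n) ∞ f o := contMDiffAt_extChartAt
    have h3 : ContMDiffAt (𝓘(ℝ, ℝ).prod (𝓡 n)) 𝓘(ℝ, ℝ × Eucl n) ∞
        (fun q : ℝ × N ↦ (q.1, f q.2)) (0, o) :=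
      contMDiffAt_fst.prodMk_space (ContMDiffAt.comp ((0 : ℝ), o) h2 contMDiffAt_snd)
    exact ContMDiffAt.comp ((0 : ℝ), o) h1 (ContMDiffAt.comp ((0 : ℝ), o) hφ.contMDiffAt h3)
  · have hball : ∀ᶠ y in 𝓝 o, f y ∈ ball (f o) (min r δ) :=
      (continuousAt_extChartAt o).eventually_mem (ball_mem_nhds _ (lt_min hr hδ))
    filter_upwards [hball, extChartAt_source_mem_nhds (I := 𝓡 n) o] with y hy hys
    obtain ⟨h0, hd⟩ := hflow (f y) (ball_subset_ball (min_le_left _ _) hy)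
    refine ⟨by rw [h0]; exact f.left_inv hys, fun s hs ↦ ?_⟩
    rw [mem_Ioo, ← abs_lt] at hs
    have hmem : φ (s, f y) ∈ f.target := hδball _ (by
      rw [← ball_prod_same]
      refine ⟨?_, ball_subset_ball (min_le_right _ _) hy⟩
      rw [mem_ball_zero_iff, Real.norm_eq_abs]
      exact hs.trans_le (min_le_right _ _))
    have h1 := (mdifferentiableAt_extChartAt_symm o hmem).hasMFDerivAt
    have h2 : HasMFDerivAt 𝓘(ℝ, ℝ) 𝓘(ℝ, Eucl n) (fun s ↦ φ (s, f y)) s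
        ((1 : ℝ →L[ℝ] ℝ).smulRight (g.coordSharp θ o (φ (s, f y)))) :=
      (hd s (by rw [mem_Ioo, ← abs_lt]; exact hs.trans_le (min_le_left _ _))).hasFDerivAt.hasMFDerivAt
    refine ((HasMFDerivAt.comp s h1 h2).congr_mfderiv ?_).hasMFDerivWithinAt
    refine ContinuousLinearMap.ext fun (c : ℝ) ↦ ?_
    change coordFrame o (φ (s, f y)) (c • g.coordSharp θ o (φ (s, f y)))
      = c • g.sharp θ (f.symm (φ (s, f y)))
    rw [map_smul, g.coordFrame_coordSharp θ o hmem]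

end LocalFlow

/-! ### The global flow of `θ^♯` on the homogeneous space `N`. -/

namespace QStructure

variable (Q : QStructure.{u, v})

theorem contMDiff_smul_left (a : Q.grp) :
    ContMDiff (𝓡 Q.dim) (𝓡 Q.dim) ∞ (fun y : Q.N ↦ a • y) :=
  Q.smooth_action.contMDiff_smul.comp (contMDiff_const.prodMk contMDiff_id)

theorem mdifferentiable_smul_left (a : Q.grp) :
    MDifferentiable (𝓡 Q.dim) (𝓡 Q.dim) (fun y : Q.N ↦ a • y) :=
  (Q.contMDiff_smul_left a).mdifferentiable (by simp)

theorem mfderiv_smul_left_surjective (a : Q.grp) (y : Q.N) :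
    Function.Surjective (mfderiv (𝓡 Q.dim) (𝓡 Q.dim) (fun z : Q.N ↦ a • z) y) := by
  intro w
  have h1 := (Q.mdifferentiable_smul_left a y).hasMFDerivAt
  have h2 := (Q.mdifferentiable_smul_left a⁻¹ (a • y)).hasMFDerivAt
  have h1' : HasMFDerivAt (𝓡 Q.dim) (𝓡 Q.dim) (fun z : Q.N ↦ a • z) (a⁻¹ • a • y)
      (mfderiv (𝓡 Q.dim) (𝓡 Q.dim) (fun z : Q.N ↦ a • z) y) := by
    have key : ∀ z : Q.N, z = y → HasMFDerivAt (𝓡 Q.dim) (𝓡 Q.dim) (fun z : Q.N ↦ a • z) z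
      (mfderiv (𝓡 Q.dim) (𝓡 Q.dim) (fun z : Q.N ↦ a • z) y) := by rintro z rfl; exact h1
    exact key _ (inv_smul_smul a y)
  have h3 := HasMFDerivAt.comp (a • y) h1' h2
  have h4 : HasMFDerivAt (𝓡 Q.dim) (𝓡 Q.dim) ((fun z : Q.N ↦ a • z) ∘ fun z : Q.N ↦ a⁻¹ • z)
      (a • y) (ContinuousLinearMap.id ℝ (Eucl Q.dim)) := by
    have he : ((fun z : Q.N ↦ a • z) ∘ fun z : Q.N ↦ a⁻¹ • z) = id := by ext z; simp
    rw [he]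
    exact hasMFDerivAt_id _
  exact ⟨_, DFunLike.congr_fun (hasMFDerivAt_unique h3 h4) w⟩

/-- The vector field `θ^♯` of a `𝔔`-structure. -/
noncomputable def field (y : Q.N) : TangentSpace (𝓡 Q.dim) y := Q.metric.sharp Q.θ y

/-- The action preserves both `g_N` and `θ`, hence the dual field. Surjectivity of the differential
allows testing against vectors in its image only. -/
theorem mfderiv_smul_field (a : Q.grp) (y : Q.N) :
    mfderiv (𝓡 Q.dim) (𝓡 Q.dim) (fun z : Q.N ↦ a • z) y (Q.field y) = Q.field (a • y) := by
  refine Q.metric.eq_of_val_eq fun w ↦ ?_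
  obtain ⟨w, rfl⟩ := Q.mfderiv_smul_left_surjective a y w
  refine (Q.isometries a y _ _).trans ?_
  rw [field, field, Q.metric.val_sharp, Q.metric.val_sharp]
  exact (Q.invariant a y w).symm

theorem isMIntegralCurveOn_smul {γ : ℝ → Q.N} {s : Set ℝ}
    (h : IsMIntegralCurveOn (I := 𝓡 Q.dim) γ Q.field s) (a : Q.grp) :
    IsMIntegralCurveOn (I := 𝓡 Q.dim) (fun t ↦ a • γ t) Q.field s := by
  intro t ht
  have h1 := (Q.mdifferentiable_smul_left a (γ t)).hasMFDerivAt
  refine (HasMFDerivAt.comp_hasMFDerivWithinAt t h1 (h t ht)).congr_mfderiv ?_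
  refine ContinuousLinearMap.ext fun (c : ℝ) ↦ ?_
  change mfderiv (𝓡 Q.dim) (𝓡 Q.dim) (fun z : Q.N ↦ a • z) (γ t) (c • Q.field (γ t))
    = c • Q.field (a • γ t)
  rw [map_smul, Q.mfderiv_smul_field]

theorem contMDiff_field {m : ℕ∞} : ContMDiff (𝓡 Q.dim) (𝓡 Q.dim).tangent m
    (fun y : Q.N ↦ (⟨y, Q.field y⟩ : TangentBundle (𝓡 Q.dim) Q.N)) :=
  (Q.metric.contMDiff_sharp Q.θ).of_le (by exact_mod_cast le_top)

/-- Translating the local flow at one point `o` by the group gives an existence time `ε` valid at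
every point, which makes the field complete. -/
theorem exists_isMIntegralCurve (y : Q.N) :
    ∃ γ : ℝ → Q.N, γ 0 = y ∧ IsMIntegralCurve (I := 𝓡 Q.dim) γ Q.field := by
  obtain ⟨o⟩ := (inferInstance : Nonempty Q.N)
  obtain ⟨φ, -, ε, hε, hφ⟩ := Q.metric.exists_local_flow_sharp Q.θ o
  have : IsManifold (𝓡 Q.dim) 1 Q.N := .of_le (n := ∞) (by simp)
  refine exists_isMIntegralCurve_of_isMIntegralCurveOn (Q.contMDiff_field (m := 1)) hε
    (fun x ↦ ?_) y
  obtain ⟨a, rfl⟩ := Q.transitive.exists_smul_eq o x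
  obtain ⟨h0, h1⟩ := hφ.self_of_nhds
  exact ⟨fun t ↦ a • φ (t, o), congr_arg (a • ·) h0, Q.isMIntegralCurveOn_smul h1 a⟩

/-- The global flow of the vector field `θ^♯`. -/
noncomputable def flow (q : ℝ × Q.N) : Q.N := (Q.exists_isMIntegralCurve q.2).choose q.1

theorem flow_zero (y : Q.N) : Q.flow (0, y) = y := (Q.exists_isMIntegralCurve y).choose_spec.1

theorem isMIntegralCurve_flow (y : Q.N) :
    IsMIntegralCurve (I := 𝓡 Q.dim) (fun s ↦ Q.flow (s, y)) Q.field :=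
  (Q.exists_isMIntegralCurve y).choose_spec.2

theorem flow_eq_of_isMIntegralCurve {γ : ℝ → Q.N}
    (h : IsMIntegralCurve (I := 𝓡 Q.dim) γ Q.field) (s : ℝ) : Q.flow (s, γ 0) = γ s := by
  have : IsManifold (𝓡 Q.dim) 1 Q.N := .of_le (n := ∞) (by simp)
  exact congr_fun (isMIntegralCurve_Ioo_eq_of_contMDiff_boundaryless (t₀ := 0)
    (Q.contMDiff_field (m := 1)) (Q.isMIntegralCurve_flow (γ 0)) h (Q.flow_zero _)) s

theorem flow_add (s t : ℝ) (y : Q.N) : Q.flow (s + t, y) = Q.flow (s, Q.flow (t, y)) := by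
  have h := (Q.isMIntegralCurve_flow y).comp_add t
  have := Q.flow_eq_of_isMIntegralCurve h s
  simp only [Function.comp_apply, zero_add] at this
  exact this.symm

theorem flow_smul (s : ℝ) (a : Q.grp) (y : Q.N) : Q.flow (s, a • y) = a • Q.flow (s, y) := by
  have h : IsMIntegralCurve (I := 𝓡 Q.dim) (fun s ↦ a • Q.flow (s, y)) Q.field := by
    rw [isMIntegralCurve_iff_isMIntegralCurveOn]
    exact Q.isMIntegralCurveOn_smul ((Q.isMIntegralCurve_flow y).isMIntegralCurveOn _) a
  have := Q.flow_eq_of_isMIntegralCurve h s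
  simpa only [Q.flow_zero] using this

theorem contMDiffAt_flow_zero (o : Q.N) :
    ContMDiffAt (𝓘(ℝ, ℝ).prod (𝓡 Q.dim)) (𝓡 Q.dim) ∞ Q.flow (0, o) := by
  have : IsManifold (𝓡 Q.dim) 1 Q.N := .of_le (n := ∞) (by simp)
  obtain ⟨φ, hφ, ε, hε, hev⟩ := Q.metric.exists_local_flow_sharp Q.θ o
  refine hφ.congr_of_eventuallyEq ?_
  have hIoo : Ioo (-ε) ε ∈ 𝓝 (0 : ℝ) := Ioo_mem_nhds (by simpa) hε
  rw [nhds_prod_eq]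
  filter_upwards [prod_mem_prod hIoo hev] with q hq
  obtain ⟨hs, h0, h1⟩ := hq
  exact isMIntegralCurveOn_Ioo_eqOn_of_contMDiff_boundaryless (t₀ := 0) ⟨by simpa, hε⟩
    (Q.contMDiff_field (m := 1)) ((Q.isMIntegralCurve_flow q.2).isMIntegralCurveOn _) h1
    ((Q.flow_zero _).trans h0.symm) hs

/-- Smoothness at `(0, o)` spreads to all points by equivariance, with a common time `δ`, and then
to all times by the group law. -/
theorem contMDiff_flow :
    ContMDiff (𝓘(ℝ, ℝ).prod (𝓡 Q.dim)) (𝓡 Q.dim) ∞ Q.flow := by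
  rw [contMDiff_infty]
  -- A finite order is fixed because being `C^m` at a point extends to a neighbourhood only for
  -- finite `m`.
  intro m
  obtain ⟨o⟩ := (inferInstance : Nonempty Q.N)
  have hm : ContMDiffAt (𝓘(ℝ, ℝ).prod (𝓡 Q.dim)) (𝓡 Q.dim) m Q.flow (0, o) :=
    (Q.contMDiffAt_flow_zero o).of_le (by exact_mod_cast le_top)
  have hnhds := (contMDiffAt_iff_contMDiffAt_nhds (by simp)).1 hm
  rw [nhds_prod_eq] at hnhds
  obtain ⟨S, hS, hSo⟩ := hnhds.curry.exists_mem
  obtain ⟨δ, hδ, hball⟩ := Metric.mem_nhds_iff.1 hS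
  have hsmall : ∀ s, |s| < δ → ∀ y : Q.N,
      ContMDiffAt (𝓘(ℝ, ℝ).prod (𝓡 Q.dim)) (𝓡 Q.dim) m Q.flow (s, y) := by
    intro s hs y
    obtain ⟨a, rfl⟩ := Q.transitive.exists_smul_eq o y
    have h1 := (hSo s (hball (by rwa [mem_ball_zero_iff, Real.norm_eq_abs]))).self_of_nhds
    have h2 : Q.flow = fun q : ℝ × Q.N ↦ a • Q.flow (q.1, a⁻¹ • q.2) := by
      ext q
      rw [← Q.flow_smul, smul_inv_smul]
    rw [h2]
    have h3 : ContMDiff (𝓘(ℝ, ℝ).prod (𝓡 Q.dim)) (𝓘(ℝ, ℝ).prod (𝓡 Q.dim)) m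
        (fun q : ℝ × Q.N ↦ (q.1, a⁻¹ • q.2)) :=
      contMDiff_fst.prodMk (((Q.contMDiff_smul_left a⁻¹).of_le
        (by exact_mod_cast le_top)).comp contMDiff_snd)
    have h4 : ContMDiffAt (𝓘(ℝ, ℝ).prod (𝓡 Q.dim)) (𝓡 Q.dim) m Q.flow
        ((fun q : ℝ × Q.N ↦ (q.1, a⁻¹ • q.2)) (s, a • o)) := by
      simpa only [inv_smul_smul] using h1
    exact ((Q.contMDiff_smul_left a).of_le (by exact_mod_cast le_top)).contMDiffAt.comp _
      (h4.comp (s, a • o) h3.contMDiffAt)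
  -- Writing `φ_s = φ_{s/2} ∘ φ_{s/2}` doubles the range of admissible times.
  have hdouble : ∀ k : ℕ, ∀ s, |s| < 2 ^ k * δ → ∀ y : Q.N,
      ContMDiffAt (𝓘(ℝ, ℝ).prod (𝓡 Q.dim)) (𝓡 Q.dim) m Q.flow (s, y) := by
    intro k
    induction k with
    | zero => simpa using hsmall
    | succ k ih =>
      intro s hs y
      have hs2 : |s / 2| < 2 ^ k * δ := by
        rw [abs_div, abs_two, div_lt_iff₀ two_pos]
        rw [pow_succ] at hs
        linarith
      have h1 : Q.flow = fun q : ℝ × Q.N ↦ Q.flow (q.1 / 2, Q.flow (q.1 / 2, q.2)) := by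
        ext q
        rw [← Q.flow_add, add_halves]
      have hhalf : ContMDiff (𝓘(ℝ, ℝ).prod (𝓡 Q.dim)) 𝓘(ℝ, ℝ) m (fun q : ℝ × Q.N ↦ q.1 / 2) :=
        ContMDiff.comp (g := fun s : ℝ ↦ s / 2)
          (contDiff_id.div_const 2).contMDiff contMDiff_fst
      rw [h1]
      have h2 : ContMDiffAt (𝓘(ℝ, ℝ).prod (𝓡 Q.dim)) (𝓡 Q.dim) m
          (fun q : ℝ × Q.N ↦ Q.flow (q.1 / 2, q.2)) (s, y) :=
        ContMDiffAt.comp (s, y) (g := Q.flow) (f := fun q : ℝ × Q.N ↦ (q.1 / 2, q.2))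
          (ih _ hs2 y) (hhalf.contMDiffAt.prodMk contMDiffAt_snd)
      exact ContMDiffAt.comp (s, y) (g := Q.flow)
        (f := fun q : ℝ × Q.N ↦ (q.1 / 2, Q.flow (q.1 / 2, q.2)))
        (ih _ hs2 _) (hhalf.contMDiffAt.prodMk h2)
  rintro ⟨s, y⟩
  obtain ⟨k, hk⟩ := pow_unbounded_of_one_lt (|s| / δ) one_lt_two
  exact hdouble k s (by rwa [div_lt_iff₀ hδ] at hk) y

end QStructure

/-! ### The flow of a Killing form, and the isometry built from it. -/

namespace PseudoRiemannianMetric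

variable {n : ℕ} {N : Type*} [TopologicalSpace N] [ChartedSpace (Eucl n) N]
  [IsManifold (𝓡 n) ∞ N] (g : PseudoRiemannianMetric n N)

/-- The pullback `f^* g`, evaluated on two tangent vectors. -/
noncomputable def pullback (f : N → N) (y : N) (v w : TangentSpace (𝓡 n) y) : ℝ :=
  g.val (f y) (mfderiv (𝓡 n) (𝓡 n) f y v) (mfderiv (𝓡 n) (𝓡 n) f y w)

theorem pullback_comp {f h : N → N} (hf : MDifferentiable (𝓡 n) (𝓡 n) f)
    (hh : MDifferentiable (𝓡 n) (𝓡 n) h) (y : N) (v w : TangentSpace (𝓡 n) y) :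
    g.pullback (f ∘ h) y v w = g.pullback f (h y) (mfderiv (𝓡 n) (𝓡 n) h y v)
      (mfderiv (𝓡 n) (𝓡 n) h y w) := by
  rw [pullback, mfderiv_comp y (hf _) (hh _)]
  rfl

theorem pullback_coordFrame (f : N → N) (p : N) (u v w : Eucl n) :
    g.pullback f ((extChartAt (𝓡 n) p).symm u) (coordFrame p u v) (coordFrame p u w)
      = ∑ a, ∑ b, v a * (w b * g.pullback f ((extChartAt (𝓡 n) p).symm u)
          (coordVector p u a) (coordVector p u b)) := by
  let B : Eucl n →L[ℝ] Eucl n →L[ℝ] ℝ := g.val (f ((extChartAt (𝓡 n) p).symm u))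
  let D : Eucl n →L[ℝ] Eucl n := mfderiv (𝓡 n) (𝓡 n) f ((extChartAt (𝓡 n) p).symm u)
  let A : Eucl n →L[ℝ] Eucl n := coordFrame p u
  have h := EuclideanSpace.apply_eq_sum ((B.bilinearComp (D ∘L A) (D ∘L A)).flip w) v
  refine h.trans (Finset.sum_congr rfl fun a _ ↦ ?_)
  rw [← Finset.mul_sum]
  congr 1
  exact EuclideanSpace.apply_eq_sum
    (B.bilinearComp (D ∘L A) (D ∘L A) (EuclideanSpace.single a 1)) w

end PseudoRiemannianMetric

namespace QStructure

variable (Q : QStructure.{u, v})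

theorem contMDiff_flow_left (s : ℝ) :
    ContMDiff (𝓡 Q.dim) (𝓡 Q.dim) ∞ (fun y ↦ Q.flow (s, y)) :=
  Q.contMDiff_flow.comp (contMDiff_const.prodMk contMDiff_id)

theorem mdifferentiable_flow_left (s : ℝ) :
    MDifferentiable (𝓡 Q.dim) (𝓡 Q.dim) (fun y ↦ Q.flow (s, y)) :=
  (Q.contMDiff_flow_left s).mdifferentiable (by simp)

theorem mfderiv_flow_right (s : ℝ) (y : Q.N) :
    mfderiv 𝓘(ℝ, ℝ) (𝓡 Q.dim) (fun s : ℝ ↦ Q.flow (s, y)) s (1 : ℝ) = Q.field (Q.flow (s, y)) := by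
  rw [(Q.isMIntegralCurve_flow y s).mfderiv]
  exact one_smul ℝ (Q.field (Q.flow (s, y)))

theorem hasDerivAt_pullback_flow_zero (hK : Q.θ.IsKilling Q.metric) (y : Q.N)
    (v w : TangentSpace (𝓡 Q.dim) y) :
    HasDerivAt (fun s ↦ Q.metric.pullback (fun z ↦ Q.flow (s, z)) y v w) 0 0 := by
  have hu : extChartAt (𝓡 Q.dim) y y ∈ (extChartAt (𝓡 Q.dim) y).target := mem_extChartAt_target y
  have hcoord : ∀ v w : Eucl Q.dim, HasDerivAt (fun s ↦ Q.metric.pullback (fun z ↦ Q.flow (s, z))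
      ((extChartAt (𝓡 Q.dim) y).symm (extChartAt (𝓡 Q.dim) y y))
      (coordFrame y (extChartAt (𝓡 Q.dim) y y) v) (coordFrame y (extChartAt (𝓡 Q.dim) y y) w)) 0 0 := by
    intro v w
    simp only [Q.metric.pullback_coordFrame]
    have h := HasDerivAt.fun_sum (u := Finset.univ) fun a _ ↦
      HasDerivAt.fun_sum (u := Finset.univ) fun b _ ↦
        ((hasDerivAt_pullback_metric Q.metric Q.θ Q.contMDiff_flow Q.flow_zero (k := 1)
          (fun z w ↦ by rw [Q.mfderiv_flow_right, one_mul]; exact Q.metric.val_sharp Q.θ _ _)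
          y hu a b).const_mul (w b)).const_mul (v a)
    refine h.congr_deriv ?_
    refine Finset.sum_eq_zero fun a _ ↦ Finset.sum_eq_zero fun b _ ↦ ?_
    rw [hK y _ hu a b, mul_zero, mul_zero, mul_zero]
  have hall : ∀ z, z = y → (∀ v w : TangentSpace (𝓡 Q.dim) z,
      HasDerivAt (fun s ↦ Q.metric.pullback (fun z ↦ Q.flow (s, z)) z v w) 0 0) →
      ∀ v w : TangentSpace (𝓡 Q.dim) y,
      HasDerivAt (fun s ↦ Q.metric.pullback (fun z ↦ Q.flow (s, z)) y v w) 0 0 := by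
    rintro z rfl h; exact h
  refine hall _ ((extChartAt (𝓡 Q.dim) y).left_inv (mem_extChartAt_source y)) (fun v w ↦ ?_) v w
  obtain ⟨v, rfl⟩ := (coordFrame_bijective y hu).2 v
  obtain ⟨w, rfl⟩ := (coordFrame_bijective y hu).2 w
  exact hcoord v w

/-- The group law `φ_t = φ_{t-s} ∘ φ_s` reduces the derivative at time `s` to the derivative at time
`0` at the point `φ_s y`, which vanishes by the Killing equation. -/
theorem pullback_flow (hK : Q.θ.IsKilling Q.metric) (s : ℝ) (y : Q.N)
    (v w : TangentSpace (𝓡 Q.dim) y) :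
    Q.metric.pullback (fun z ↦ Q.flow (s, z)) y v w = Q.metric.val y v w := by
  have hder : ∀ s, HasDerivAt (fun s ↦ Q.metric.pullback (fun z ↦ Q.flow (s, z)) y v w) 0 s := by
    intro s
    have h1 := Q.hasDerivAt_pullback_flow_zero hK (Q.flow (s, y))
      (mfderiv (𝓡 Q.dim) (𝓡 Q.dim) (fun z ↦ Q.flow (s, z)) y v)
      (mfderiv (𝓡 Q.dim) (𝓡 Q.dim) (fun z ↦ Q.flow (s, z)) y w)
    have h2 : ∀ t, Q.metric.pullback (fun z ↦ Q.flow (t, z)) y v w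
        = Q.metric.pullback (fun z ↦ Q.flow (t - s, z)) (Q.flow (s, y))
          (mfderiv (𝓡 Q.dim) (𝓡 Q.dim) (fun z ↦ Q.flow (s, z)) y v)
          (mfderiv (𝓡 Q.dim) (𝓡 Q.dim) (fun z ↦ Q.flow (s, z)) y w) := by
      intro t
      have h3 : (fun z ↦ Q.flow (t, z)) = (fun z ↦ Q.flow (t - s, z)) ∘ fun z ↦ Q.flow (s, z) := by
        ext z
        rw [Function.comp_apply, ← Q.flow_add, sub_add_cancel]
      rw [h3, Q.metric.pullback_comp (Q.mdifferentiable_flow_left _) (Q.mdifferentiable_flow_left _)]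
    have h4 : HasDerivAt (fun t : ℝ ↦ t - s) 1 s := (hasDerivAt_id s).sub_const s
    have h5 := HasDerivAt.comp s (h₂ := fun r ↦ Q.metric.pullback (fun z ↦ Q.flow (r, z))
      (Q.flow (s, y)) (mfderiv (𝓡 Q.dim) (𝓡 Q.dim) (fun z ↦ Q.flow (s, z)) y v)
      (mfderiv (𝓡 Q.dim) (𝓡 Q.dim) (fun z ↦ Q.flow (s, z)) y w)) (by rw [sub_self]; exact h1) h4
    rw [zero_mul] at h5
    exact h5.congr_of_eventuallyEq (Eventually.of_forall h2)
  have hconst := is_const_of_deriv_eq_zero (fun s ↦ (hder s).differentiableAt)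
    (fun s ↦ (hder s).deriv) s 0
  rw [hconst]
  have h0 : (fun z ↦ Q.flow (0, z)) = id := funext Q.flow_zero
  rw [h0, PseudoRiemannianMetric.pullback, mfderiv_id]
  rfl

/-- Differentiate `φ_s ∘ φ_h = φ_h ∘ φ_s` in `h` at `0`. -/
theorem mfderiv_flow_field (s : ℝ) (y : Q.N) :
    mfderiv (𝓡 Q.dim) (𝓡 Q.dim) (fun z ↦ Q.flow (s, z)) y (Q.field y) = Q.field (Q.flow (s, y)) := by
  have h1 : HasMFDerivAt 𝓘(ℝ, ℝ) (𝓡 Q.dim) ((fun z ↦ Q.flow (s, z)) ∘ fun h ↦ Q.flow (h, y)) 0 _ :=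
    HasMFDerivAt.comp (f := fun h : ℝ ↦ Q.flow (h, y)) (0 : ℝ)
    (Q.mdifferentiable_flow_left s (Q.flow (0, y))).hasMFDerivAt (Q.isMIntegralCurve_flow y 0)
  have h2 := Q.isMIntegralCurve_flow (Q.flow (s, y)) 0
  have h3 : ((fun z ↦ Q.flow (s, z)) ∘ fun h ↦ Q.flow (h, y))
      = fun h ↦ Q.flow (h, Q.flow (s, y)) := by
    ext h
    rw [Function.comp_apply, ← Q.flow_add, ← Q.flow_add, add_comm]
  rw [h3] at h1
  have h4 := DFunLike.congr_fun (hasMFDerivAt_unique h1 h2) (1 : ℝ)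
  have h5 : mfderiv (𝓡 Q.dim) (𝓡 Q.dim) (fun z ↦ Q.flow (s, z)) (Q.flow (0, y))
      ((1 : ℝ) • Q.field (Q.flow (0, y))) = (1 : ℝ) • Q.field (Q.flow (0, Q.flow (s, y))) := h4
  rw [one_smul, one_smul] at h5
  have key : ∀ z z' : Q.N, z = y → z' = Q.flow (s, y) →
      (mfderiv (𝓡 Q.dim) (𝓡 Q.dim) (fun z ↦ Q.flow (s, z)) z (Q.field z) : Eucl Q.dim)
        = (Q.field z' : Eucl Q.dim) →
      (mfderiv (𝓡 Q.dim) (𝓡 Q.dim) (fun z ↦ Q.flow (s, z)) y (Q.field y) : Eucl Q.dim)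
        = (Q.field (Q.flow (s, y)) : Eucl Q.dim) := by
    rintro z z' rfl rfl h; exact h
  exact key _ _ (Q.flow_zero y) (Q.flow_zero _) h5

theorem val_mfderiv_flow (hK : Q.θ.IsKilling Q.metric) (s : ℝ) (y : Q.N)
    (v : TangentSpace (𝓡 Q.dim) y) :
    Q.θ.val (Q.flow (s, y)) (mfderiv (𝓡 Q.dim) (𝓡 Q.dim) (fun z ↦ Q.flow (s, z)) y v)
      = Q.θ.val y v := by
  rw [← Q.metric.val_sharp, ← Q.metric.val_sharp]
  have h := Q.pullback_flow hK s y (Q.field y) v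
  rw [PseudoRiemannianMetric.pullback, Q.mfderiv_flow_field] at h
  exact h

theorem exists_norm_sq_field : ∃ c : ℝ, ∀ y, Q.θ.val y (Q.field y) = c := by
  obtain ⟨o⟩ := (inferInstance : Nonempty Q.N)
  refine ⟨Q.θ.val o (Q.field o), fun y ↦ ?_⟩
  obtain ⟨a, rfl⟩ := Q.transitive.exists_smul_eq o y
  rw [← Q.mfderiv_smul_field]
  exact Q.invariant a o _

/-- The vector `(1, -θ^♯)` has square norm `1 - |θ|²` in `g_{0,Q}`. -/
theorem val_field_lt_one (hQ : Q.IsRiemannian) (y : Q.N) : Q.θ.val y (Q.field y) < 1 := by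
  have h := hQ 0 (0, y) ((1 : ℝ), -Q.field y) (fun h ↦ one_ne_zero (congr_arg Prod.fst h : (1 : ℝ) = 0))
  have h1 : Q.form 0 (0, y) ((1 : ℝ), -Q.field y) ((1 : ℝ), -Q.field y)
      = Real.exp (0 * 0) * (1 * 1 + (1 * Q.θ.val y (-Q.field y) + Q.θ.val y (-Q.field y) * 1)
        + Q.metric.val y (-Q.field y) (-Q.field y)) := rfl
  rw [h1, map_neg, map_neg, map_neg, neg_apply, neg_neg] at h
  have h2 : Q.metric.val y (Q.field y) (Q.field y) = Q.θ.val y (Q.field y) :=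
    Q.metric.val_sharp Q.θ y _
  rw [h2] at h
  simp only [zero_mul, Real.exp_zero] at h
  linarith

/-- The `𝔔`-structure obtained by replacing `θ` by `0`. -/
@[reducible] noncomputable def withZeroForm : QStructure.{u, v} :=
  { Q with
    θ := ⟨fun _ ↦ 0, contMDiff_zeroSection ℝ (fun y : Q.N ↦ TangentSpace (𝓡 Q.dim) y →L[ℝ] ℝ)⟩
    invariant := fun _ _ _ ↦ rfl }

/-- If `θ` is a Killing form, then `(x, y) ↦ (α x, φ_x y)` is an isometry, where `φ` is the flow of
`θ^♯` and `α² + |θ|² = 1`. -/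
theorem exists_isometric_of_isKilling (hQ : Q.IsRiemannian) (hK : Q.θ.IsKilling Q.metric) (t : ℝ) :
    ∃ (t' : ℝ) (Q' : QStructure.{u, v}), (∀ y : Q'.N, Q'.θ.val y = 0) ∧ Q.Isometric t Q' t' := by
  obtain ⟨c, hc⟩ := Q.exists_norm_sq_field
  have hc1 : c < 1 := by
    obtain ⟨o⟩ := (inferInstance : Nonempty Q.N)
    rw [← hc o]
    exact Q.val_field_lt_one hQ o
  set α : ℝ := √(1 - c) with hα
  have hα0 : 0 < α := Real.sqrt_pos.2 (by linarith)
  have hα2 : α * α = 1 - c := Real.mul_self_sqrt (by linarith)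
  have hsmooth1 : ContMDiff Q.model Q.model ∞ (fun q : ℝ × Q.N ↦ (α * q.1, Q.flow q)) :=
    (ContMDiff.comp (g := fun s : ℝ ↦ α * s) (contDiff_const.mul contDiff_id).contMDiff
      contMDiff_fst).prodMk Q.contMDiff_flow
  have hsmooth2 : ContMDiff Q.model Q.model ∞
      (fun q : ℝ × Q.N ↦ (α⁻¹ * q.1, Q.flow (-(α⁻¹ * q.1), q.2))) := by
    refine (ContMDiff.comp (g := fun s : ℝ ↦ α⁻¹ * s) (contDiff_const.mul contDiff_id).contMDiff
      contMDiff_fst).prodMk (Q.contMDiff_flow.comp (ContMDiff.prodMk ?_ contMDiff_snd))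
    exact ContMDiff.comp (g := fun s : ℝ ↦ -(α⁻¹ * s))
      (contDiff_const.mul contDiff_id).neg.contMDiff contMDiff_fst
  refine ⟨t / α, Q.withZeroForm, fun _ ↦ rfl, ⟨⟨fun q ↦ (α * q.1, Q.flow q),
    fun q ↦ (α⁻¹ * q.1, Q.flow (-(α⁻¹ * q.1), q.2)), fun q ↦ ?_, fun q ↦ ?_⟩, hsmooth1, hsmooth2⟩, ?_⟩
  · simp only [inv_mul_cancel_left₀ hα0.ne', ← Q.flow_add, neg_add_cancel, Q.flow_zero]
  · simp only [mul_inv_cancel_left₀ hα0.ne', ← Q.flow_add, add_neg_cancel, Q.flow_zero]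
  · rintro ⟨x, y⟩ v w
    have hd : ∀ v : TangentSpace Q.model (x, y),
        mfderiv Q.model Q.model (fun q : ℝ × Q.N ↦ (α * q.1, Q.flow q)) (x, y) v
          = ((α * v.1 : ℝ), (v.1 : ℝ) • Q.field (Q.flow (x, y))
            + mfderiv (𝓡 Q.dim) (𝓡 Q.dim) (fun z ↦ Q.flow (x, z)) y v.2) := by
      intro v
      have h1 : HasMFDerivAt Q.model 𝓘(ℝ, ℝ) (fun q : ℝ × Q.N ↦ α * q.1) (x, y)
          ((α • ContinuousLinearMap.id ℝ ℝ) ∘L ContinuousLinearMap.fst ℝ ℝ (Eucl Q.dim)) :=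
        HasMFDerivAt.comp (g := fun s : ℝ ↦ α * s) (x, y)
          ((hasFDerivAt_id x).const_mul α).hasMFDerivAt (hasMFDerivAt_fst (x, y))
      have h2 : MDifferentiableAt Q.model (𝓡 Q.dim) Q.flow (x, y) :=
        Q.contMDiff_flow.mdifferentiable (by simp) _
      rw [(h1.prodMk h2.hasMFDerivAt).mfderiv]
      refine Prod.ext rfl ?_
      refine (mfderiv_prod_eq_add_apply h2).trans ?_
      congr 1
      have h3 : ∀ r : ℝ, mfderiv 𝓘(ℝ, ℝ) (𝓡 Q.dim) (fun s : ℝ ↦ Q.flow (s, y)) x r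
          = r • Q.field (Q.flow (x, y)) := fun r ↦ by
        rw [(Q.isMIntegralCurve_flow y x).mfderiv]; rfl
      exact h3 v.1
    have hA : ∀ v w : TangentSpace (𝓡 Q.dim) y,
        Q.metric.val (Q.flow (x, y)) (mfderiv (𝓡 Q.dim) (𝓡 Q.dim) (fun z ↦ Q.flow (x, z)) y v)
          (mfderiv (𝓡 Q.dim) (𝓡 Q.dim) (fun z ↦ Q.flow (x, z)) y w) = Q.metric.val y v w :=
      Q.pullback_flow hK x y
    have hB := Q.val_mfderiv_flow hK x y
    have hX : ∀ w, Q.metric.val (Q.flow (x, y)) (Q.field (Q.flow (x, y))) w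
      = Q.θ.val (Q.flow (x, y)) w := Q.metric.val_sharp Q.θ _
    -- Expanding the product gives `c r s` together with the mixed `θ` terms; `α² + c = 1` closes
    -- the identity.
    have hform : ∀ (r s : ℝ) (A B : TangentSpace (𝓡 Q.dim) y),
        Real.exp (t / α * (α * x)) * (α * r * (α * s) + (α * r * 0 + 0 * (α * s))
            + Q.metric.val (Q.flow (x, y))
              (r • Q.field (Q.flow (x, y))
                + mfderiv (𝓡 Q.dim) (𝓡 Q.dim) (fun z ↦ Q.flow (x, z)) y A)
              (s • Q.field (Q.flow (x, y))
                + mfderiv (𝓡 Q.dim) (𝓡 Q.dim) (fun z ↦ Q.flow (x, z)) y B))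
          = Real.exp (t * x) * (r * s + (r * Q.θ.val y B + Q.θ.val y A * s)
            + Q.metric.val y A B) := by
      intro r s A B
      rw [show t / α * (α * x) = t * x by field_simp]
      simp only [map_add, map_smul, add_apply, smul_apply, smul_eq_mul, hA]
      rw [Q.metric.symm _ (mfderiv (𝓡 Q.dim) (𝓡 Q.dim) (fun z ↦ Q.flow (x, z)) y A)]
      simp only [hX, hB, hc]
      linear_combination Real.exp (t * x) * r * s * hα2
    exact (congrArg₂ (Q.withZeroForm.form (t / α) (α * x, Q.flow (x, y))) (hd v) (hd w)).trans
      (hform v.1 w.1 v.2 w.2)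

end QStructure

/-! ### Completeness of Riemannian homogeneous spaces. -/

/-- A function whose derivative is dominated by that of `ℓ` moves at most as much as `ℓ`. -/
theorem abs_sub_le_of_abs_deriv_le {f f' ℓ ℓ' : ℝ → ℝ} {C r s : ℝ} (hr : 0 ≤ r) (hrs : r ≤ s)
    (hf : ∀ s, 0 ≤ s → HasDerivAt f (f' s) s) (hℓ : ∀ s, 0 ≤ s → HasDerivAt ℓ (ℓ' s) s)
    (hle : ∀ s, 0 ≤ s → |f' s| ≤ C * ℓ' s) : |f s - f r| ≤ C * (ℓ s - ℓ r) := by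
  have hB : ∀ x, 0 ≤ x → HasDerivAt (fun x ↦ C * (ℓ x - ℓ r)) (C * ℓ' x) x :=
    fun x hx ↦ ((hℓ x hx).sub_const _).const_mul C
  have hF : ∀ x, 0 ≤ x → HasDerivAt (fun x ↦ f x - f r) (f' x) x :=
    fun x hx ↦ (hf x hx).sub_const _
  exact image_norm_le_of_norm_deriv_right_le_deriv_boundary' (a := r) (b := s)
    (f := fun x ↦ f x - f r) (B := fun x ↦ C * (ℓ x - ℓ r))
    (fun x hx ↦ (hF x (hr.trans hx.1)).continuousAt.continuousWithinAt)
    (fun x hx ↦ (hF x (hr.trans hx.1)).hasDerivWithinAt) (by simp)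
    (fun x hx ↦ (hB x (hr.trans hx.1)).continuousAt.continuousWithinAt)
    (fun x hx ↦ (hB x (hr.trans hx.1)).hasDerivWithinAt)
    (fun x hx ↦ hle x (hr.trans hx.1)) (right_mem_Icc.2 hrs)

section Bump

variable {n : ℕ} {N : Type*} [TopologicalSpace N] [ChartedSpace (Eucl n) N]
  [IsManifold (𝓡 n) ∞ N] (g : PseudoRiemannianMetric n N)

/-- The differential of a real-valued function. -/
noncomputable def differential (f : N → ℝ) (y : N) : TangentSpace (𝓡 n) y →L[ℝ] ℝ :=
  mfderiv (𝓡 n) 𝓘(ℝ, ℝ) f y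

/-- The inverse of `g(w, w)` is continuous on the compact set `K` times the unit sphere, hence
bounded; homogeneity in `w` does the rest. -/
theorem PseudoRiemannianMetric.exists_sq_norm_le_coord
    (hg : ∀ y v, v ≠ 0 → 0 < g.val y v v) (o : N) {K : Set (Eucl n)} (hK : IsCompact K)
    (hKt : K ⊆ (extChartAt (𝓡 n) o).target) :
    ∃ C, 0 ≤ C ∧ ∀ u ∈ K, ∀ w : Eucl n, ‖w‖ ^ 2 ≤ C * g.coord o u w w := by
  have hpos : ∀ u ∈ K, ∀ w : Eucl n, w ≠ 0 → 0 < g.coord o u w w := fun u hu w hw ↦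
    hg _ _ fun h ↦ hw ((coordFrame_bijective o (hKt hu)).1 (h.trans (map_zero _).symm))
  have hcont : ContinuousOn (fun q : Eucl n × Eucl n ↦ g.coord o q.1 q.2 q.2)
      (K ×ˢ sphere (0 : Eucl n) 1) := by
    have h1 : ContinuousOn (fun q : Eucl n × Eucl n ↦ g.coord o q.1) (K ×ˢ sphere (0 : Eucl n) 1) :=
      (g.contDiffOn_coord o).continuousOn.comp continuousOn_fst fun q hq ↦ hKt hq.1
    exact (h1.clm_apply continuousOn_snd).clm_apply continuousOn_snd
  have hne : ∀ w ∈ sphere (0 : Eucl n) 1, w ≠ 0 := by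
    rintro w hw rfl
    rw [mem_sphere_zero_iff_norm, norm_zero] at hw
    exact zero_ne_one hw
  obtain ⟨C, hC⟩ := (hK.prod (isCompact_sphere (0 : Eucl n) 1)).exists_bound_of_continuousOn
    (hcont.inv₀ fun q hq ↦ (hpos q.1 hq.1 q.2 (hne _ hq.2)).ne')
  refine ⟨max C 0, le_max_right _ _, fun u hu w ↦ ?_⟩
  rcases eq_or_ne w 0 with rfl | hw
  · rw [norm_zero, map_zero, mul_zero, zero_pow two_ne_zero]
  · have hnw : ‖w‖ ≠ 0 := norm_ne_zero_iff.2 hw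
    have hmem : ‖w‖⁻¹ • w ∈ sphere (0 : Eucl n) 1 := by
      rw [mem_sphere_zero_iff_norm, norm_smul, norm_inv, norm_norm, inv_mul_cancel₀ hnw]
    have h1 := hC (u, ‖w‖⁻¹ • w) ⟨hu, hmem⟩
    have h2 := hpos u hu w hw
    have h3 : g.coord o u (‖w‖⁻¹ • w) (‖w‖⁻¹ • w) = ‖w‖⁻¹ * (‖w‖⁻¹ * g.coord o u w w) := by
      rw [(g.coord o u).map_smul, smul_apply, (g.coord o u w).map_smul, smul_eq_mul, smul_eq_mul]
    rw [Real.norm_eq_abs] at h1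
    have h4 : (g.coord o u (‖w‖⁻¹ • w) (‖w‖⁻¹ • w))⁻¹ ≤ max C 0 :=
      (le_abs_self _).trans (h1.trans (le_max_left C 0))
    rw [h3, mul_inv, mul_inv, inv_inv, ← mul_assoc, ← div_eq_mul_inv, div_le_iff₀ h2] at h4
    rwa [sq]

/-- A smooth function supported in a compact part of a chart is Lipschitz in the sense that its
differential is bounded with respect to a positive definite metric. -/
theorem SmoothBumpFunction.exists_differential_sq_le [T2Space N]
    (hg : ∀ y v, v ≠ 0 → 0 < g.val y v v) {o : N} (h : SmoothBumpFunction (𝓡 n) o) :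
    ∃ C, 0 < C ∧ ∀ (y : N) (v : TangentSpace (𝓡 n) y),
      differential h y v ^ 2 ≤ C ^ 2 * g.val y v v := by
  set e := extChartAt (𝓡 n) o with he
  have hsub : tsupport h ⊆ e.source := h.tsupport_subset_extChartAt_source
  have hK : IsCompact (e '' tsupport h) :=
    h.hasCompactSupport.isCompact.image_of_continuousOn ((continuousOn_extChartAt o).mono hsub)
  have hKt : e '' tsupport h ⊆ e.target := by
    rintro _ ⟨y, hy, rfl⟩
    exact e.map_source (hsub hy)
  have hsm : ContDiffOn ℝ ∞ (h ∘ e.symm) e.target := by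
    rw [← contMDiffOn_iff_contDiffOn]
    exact h.contMDiff.comp_contMDiffOn (contMDiffOn_extChartAt_symm o)
  have hopen : IsOpen e.target := isOpen_extChartAt_target o
  obtain ⟨A, hA⟩ := hK.exists_bound_of_continuousOn
    ((hsm.continuousOn_fderiv_of_isOpen hopen (by simp)).mono hKt)
  obtain ⟨B, hB0, hB⟩ := g.exists_sq_norm_le_coord hg o hK hKt
  have hnn : ∀ (y : N) (v : TangentSpace (𝓡 n) y), 0 ≤ g.val y v v := by
    intro y v
    rcases eq_or_ne v 0 with rfl | hv
    · simp
    · exact (hg y v hv).le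
  -- `A` bounds the derivative in the chart and `B` compares Euclidean and metric norms; the summand
  -- `1` keeps the constant positive.
  refine ⟨√(A ^ 2 * B + 1), Real.sqrt_pos.2 (by positivity), fun y v ↦ ?_⟩
  rw [Real.sq_sqrt (by positivity)]
  by_cases hy : y ∈ tsupport h
  · have hmain : ∀ u ∈ e '' tsupport h, ∀ w : Eucl n,
        differential h (e.symm u) (coordFrame o u w) ^ 2
          ≤ (A ^ 2 * B + 1) * g.val (e.symm u) (coordFrame o u w) (coordFrame o u w) := by
      intro u hu w
      have h1 : mfderiv 𝓘(ℝ, Eucl n) 𝓘(ℝ, ℝ) (h ∘ e.symm) u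
          = (mfderiv (𝓡 n) 𝓘(ℝ, ℝ) h (e.symm u)).comp (coordFrame o u) :=
        mfderiv_comp u (h.contMDiff.mdifferentiable (by simp) _)
          (mdifferentiableAt_extChartAt_symm o (hKt hu))
      rw [mfderiv_eq_fderiv] at h1
      have h2 : differential h (e.symm u) (coordFrame o u w)
          = fderiv ℝ (h ∘ e.symm) u w := (DFunLike.congr_fun h1 w).symm
      rw [h2]
      have h3 := (fderiv ℝ (h ∘ e.symm) u).le_of_opNorm_le (hA u hu) w
      rw [Real.norm_eq_abs] at h3
      have h4 := hB u hu w
      have h5 : 0 ≤ g.coord o u w w := hnn _ _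
      calc fderiv ℝ (h ∘ e.symm) u w ^ 2 = |fderiv ℝ (h ∘ e.symm) u w| ^ 2 := (sq_abs _).symm
        _ ≤ (A * ‖w‖) ^ 2 := by gcongr
        _ = A ^ 2 * ‖w‖ ^ 2 := by ring
        _ ≤ A ^ 2 * (B * g.coord o u w w) := by gcongr
        _ ≤ (A ^ 2 * B + 1) * g.coord o u w w := by linarith
    have key : ∀ z, z = y → (∀ w : TangentSpace (𝓡 n) z,
        differential h z w ^ 2 ≤ (A ^ 2 * B + 1) * g.val z w w) →
        differential h y v ^ 2 ≤ (A ^ 2 * B + 1) * g.val y v v := by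
      rintro z rfl hz; exact hz v
    refine key _ (e.left_inv (hsub hy)) fun w ↦ ?_
    obtain ⟨w, rfl⟩ := (coordFrame_bijective o (hKt (mem_image_of_mem e hy))).2 w
    exact hmain _ (mem_image_of_mem e hy) w
  · have h1 : (h : N → ℝ) =ᶠ[𝓝 y] fun _ ↦ 0 := notMem_tsupport_iff_eventuallyEq.1 hy
    have h2 : differential h y v = 0 := by
      rw [differential, h1.mfderiv_eq, mfderiv_const]; rfl
    rw [h2, zero_pow two_ne_zero]
    have := hnn y v
    positivity

end Bump

namespace QStructure

variable (Q : QStructure.{u, v})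

/-- Curves of finite length stay in a compact set: homogeneous spaces are complete. -/
theorem exists_isCompact_of_length_le (hg : ∀ y v, v ≠ 0 → 0 < Q.metric.val y v v) {σ : ℝ → Q.N}
    (hσ : ContMDiff 𝓘(ℝ, ℝ) (𝓡 Q.dim) ∞ σ) {ℓ ℓ' : ℝ → ℝ} {L : ℝ}
    (hℓ : ∀ s, 0 ≤ s → HasDerivAt ℓ (ℓ' s) s) (hℓ0 : ∀ s, 0 ≤ s → 0 ≤ ℓ' s)
    (hL : ∀ s, 0 ≤ s → ℓ s ≤ L)
    (hlen : ∀ s, 0 ≤ s → Q.metric.val (σ s) (mfderiv 𝓘(ℝ, ℝ) (𝓡 Q.dim) σ s (1 : ℝ))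
      (mfderiv 𝓘(ℝ, ℝ) (𝓡 Q.dim) σ s (1 : ℝ)) ≤ ℓ' s ^ 2) :
    ∃ K : Set Q.N, IsCompact K ∧ ∀ s, 0 ≤ s → σ s ∈ K := by
  obtain ⟨o⟩ := (inferInstance : Nonempty Q.N)
  obtain ⟨h⟩ := (inferInstance : Nonempty (SmoothBumpFunction (𝓡 Q.dim) o))
  obtain ⟨C, hC0, hC⟩ := h.exists_differential_sq_le Q.metric hg
  -- As `ℓ` is bounded, it grows by at most `1 / (2C)` after some time `r`. Moving `σ r` to `o`,
  -- where the bump function is `1`, the function drops by at most `1/2` along the tail, so the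
  -- translated tail stays in its compact support.
  have htail : ∃ r, 0 ≤ r ∧ ∀ s, r ≤ s → ℓ s ≤ ℓ r + 1 / (2 * C) := by
    have hne : (ℓ '' Ici 0).Nonempty := ⟨ℓ 0, 0, self_mem_Ici, rfl⟩
    have hbdd : BddAbove (ℓ '' Ici 0) := ⟨L, by rintro _ ⟨s, hs, rfl⟩; exact hL s hs⟩
    obtain ⟨_, ⟨r, hr, rfl⟩, hlt⟩ := exists_lt_of_lt_csSup hne
      (sub_lt_self (sSup (ℓ '' Ici 0)) (by positivity : 0 < 1 / (2 * C)))
    refine ⟨r, hr, fun s hs ↦ ?_⟩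
    have := le_csSup hbdd ⟨s, (mem_Ici.1 hr).trans hs, rfl⟩
    linarith
  obtain ⟨r, hr, htail⟩ := htail
  obtain ⟨a, ha⟩ := Q.transitive.exists_smul_eq (σ r) o
  have hτ : MDifferentiable 𝓘(ℝ, ℝ) (𝓡 Q.dim) (fun s ↦ a • σ s) :=
    ((Q.contMDiff_smul_left a).comp hσ).mdifferentiable (by simp)
  have hder : ∀ s, mfderiv 𝓘(ℝ, ℝ) (𝓡 Q.dim) (fun s ↦ a • σ s) s (1 : ℝ)
      = mfderiv (𝓡 Q.dim) (𝓡 Q.dim) (fun z : Q.N ↦ a • z) (σ s)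
        (mfderiv 𝓘(ℝ, ℝ) (𝓡 Q.dim) σ s (1 : ℝ)) := fun s ↦
    DFunLike.congr_fun (mfderiv_comp s (Q.mdifferentiable_smul_left a (σ s))
      (hσ.mdifferentiable (by simp) s)) (1 : ℝ)
  have hf : ∀ s, HasDerivAt (fun s ↦ h (a • σ s)) (differential h (a • σ s)
      (mfderiv 𝓘(ℝ, ℝ) (𝓡 Q.dim) (fun s ↦ a • σ s) s (1 : ℝ))) s := by
    intro s
    have h1 : HasMFDerivAt 𝓘(ℝ, ℝ) 𝓘(ℝ, ℝ) (fun s ↦ h (a • σ s)) s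
        ((differential h (a • σ s)).comp (mfderiv 𝓘(ℝ, ℝ) (𝓡 Q.dim) (fun s ↦ a • σ s) s)) :=
      HasMFDerivAt.comp (f := fun s ↦ a • σ s) s
        (h.contMDiff.mdifferentiable (by simp) _).hasMFDerivAt (hτ s).hasMFDerivAt
    let D : ℝ →L[ℝ] ℝ :=
      (differential h (a • σ s)).comp (mfderiv 𝓘(ℝ, ℝ) (𝓡 Q.dim) (fun s ↦ a • σ s) s)
    have h2 : HasFDerivAt (fun s ↦ h (a • σ s)) D s := h1.hasFDerivAt
    exact h2.hasDerivAt
  have hbound := fun s (hs : r ≤ s) ↦ abs_sub_le_of_abs_deriv_le (C := C) hr hs (fun s _ ↦ hf s) hℓ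
    (fun s hs ↦ by
      refine abs_le_of_sq_le_sq' ?_ ?_ |> abs_le.2
      · refine (hC _ _).trans ?_
        rw [mul_pow, hder]
        refine mul_le_mul_of_nonneg_left ?_ (sq_nonneg C)
        exact (Q.isometries a _ _ _).le.trans (hlen s hs)
      · exact mul_nonneg hC0.le (hℓ0 s hs))
  have hmem : ∀ s, r ≤ s → a • σ s ∈ tsupport h := by
    intro s hs
    refine subset_tsupport _ ?_
    have h1 := (hbound s hs).trans (mul_le_mul_of_nonneg_left
      (sub_le_iff_le_add'.2 (htail s hs)) hC0.le)
    have h2 : h (a • σ r) = 1 := by rw [ha, h.eq_one]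
    have h3 : C * (1 / (2 * C)) = 1 / 2 := by field_simp
    rw [h3, h2] at h1
    have := (abs_le.1 h1).1
    rw [Function.mem_support]
    linarith
  refine ⟨σ '' Icc 0 r ∪ (fun z : Q.N ↦ a⁻¹ • z) '' tsupport h,
    (isCompact_Icc.image hσ.continuous).union
      (h.hasCompactSupport.isCompact.image (Q.contMDiff_smul_left a⁻¹).continuous), fun s hs ↦ ?_⟩
  rcases le_total s r with hsr | hsr
  · exact Or.inl ⟨s, ⟨hs, hsr⟩, rfl⟩
  · exact Or.inr ⟨a • σ s, hmem s hsr, inv_smul_smul a _⟩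

end QStructure

/-! ### Lengths of escaping curves as a metric description of the height `x`. -/

namespace QStructure

variable (Q Q' : QStructure.{u, v})

/-- From `p` one can leave every compact set of `M_{t,Q}` along a smooth curve of length at
most `L`. -/
def EscapesWithin (t : ℝ) (p : ℝ × Q.N) (L : ℝ) : Prop :=
  ∃ (γ : ℝ → ℝ × Q.N) (ℓ ℓ' : ℝ → ℝ), ContMDiff 𝓘(ℝ, ℝ) Q.model ∞ γ ∧ γ 0 = p ∧ ℓ 0 = 0 ∧
    (∀ s, 0 ≤ s → HasDerivAt ℓ (ℓ' s) s ∧ 0 ≤ ℓ' s ∧ ℓ s ≤ L ∧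
      Q.form t (γ s) (mfderiv 𝓘(ℝ, ℝ) Q.model γ s (1 : ℝ)) (mfderiv 𝓘(ℝ, ℝ) Q.model γ s (1 : ℝ))
        ≤ ℓ' s ^ 2) ∧
    ∀ K, IsCompact K → ∃ s, 0 ≤ s ∧ γ s ∉ K

variable {Q Q'}

theorem EscapesWithin.mono {t : ℝ} {p : ℝ × Q.N} {L L' : ℝ} (h : Q.EscapesWithin t p L)
    (hL : L ≤ L') : Q.EscapesWithin t p L' := by
  obtain ⟨γ, ℓ, ℓ', hγ, h0, hℓ0, hs, hK⟩ := h
  exact ⟨γ, ℓ, ℓ', hγ, h0, hℓ0, fun s h0 ↦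
    ⟨(hs s h0).1, (hs s h0).2.1, (hs s h0).2.2.1.trans hL, (hs s h0).2.2.2⟩, hK⟩

/-- `F` multiplies lengths by `c`. If `F ∘ γ` stayed in a compact `K`, then `γ` would stay in the
compact set `G(K)`. -/
theorem EscapesWithin.map {t t' c L : ℝ} {p : ℝ × Q.N} (h : Q.EscapesWithin t p L) (hc : 0 ≤ c)
    {F : ℝ × Q.N → ℝ × Q'.N} (hF : ContMDiff Q.model Q'.model ∞ F)
    {G : ℝ × Q'.N → ℝ × Q.N} (hG : Continuous G) (hGF : Function.LeftInverse G F)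
    (hform : ∀ p v, Q'.form t' (F p) (mfderiv Q.model Q'.model F p v)
      (mfderiv Q.model Q'.model F p v) = c ^ 2 * Q.form t p v v) :
    Q'.EscapesWithin t' (F p) (c * L) := by
  obtain ⟨γ, ℓ, ℓ', hγ, rfl, hℓ0, hs, hK⟩ := h
  refine ⟨F ∘ γ, fun s ↦ c * ℓ s, fun s ↦ c * ℓ' s, hF.comp hγ, rfl, by simp [hℓ0],
    fun s h0 ↦ ?_, fun K hKc ↦ ?_⟩
  · obtain ⟨h1, h2, h3, h4⟩ := hs s h0
    refine ⟨h1.const_mul c, mul_nonneg hc h2, mul_le_mul_of_nonneg_left h3 hc, ?_⟩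
    rw [mfderiv_comp s (hF.mdifferentiable (by simp) _) (hγ.mdifferentiable (by simp) s), mul_pow]
    exact (hform (γ s) _).le.trans (mul_le_mul_of_nonneg_left h4 (sq_nonneg c))
  · obtain ⟨s, h0, hs⟩ := hK _ (hKc.image hG)
    exact ⟨s, h0, fun h ↦ hs ⟨F (γ s), h, hGF (γ s)⟩⟩

variable (Q) in
/-- Translation in the `ℝ` direction combined with the action of the group. -/
def translate (s : ℝ) (a : Q.grp) (q : ℝ × Q.N) : ℝ × Q.N := (q.1 + s, a • q.2)

theorem contMDiff_translate (s : ℝ) (a : Q.grp) :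
    ContMDiff Q.model Q.model ∞ (Q.translate s a) :=
  (ContMDiff.comp (g := fun r : ℝ ↦ r + s) (contDiff_id.add contDiff_const).contMDiff
    contMDiff_fst).prodMk ((Q.contMDiff_smul_left a).comp contMDiff_snd)

theorem mfderiv_translate (s : ℝ) (a : Q.grp) (q : ℝ × Q.N) (v : TangentSpace Q.model q) :
    mfderiv Q.model Q.model (Q.translate s a) q v
      = (v.1, mfderiv (𝓡 Q.dim) (𝓡 Q.dim) (fun z : Q.N ↦ a • z) q.2 v.2) := by
  have h1 : HasMFDerivAt Q.model 𝓘(ℝ, ℝ) (fun q : ℝ × Q.N ↦ q.1 + s) q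
      ((ContinuousLinearMap.id ℝ ℝ) ∘L ContinuousLinearMap.fst ℝ ℝ (Eucl Q.dim)) :=
    HasMFDerivAt.comp (g := fun r : ℝ ↦ r + s) q
      ((hasFDerivAt_id q.1).add_const s).hasMFDerivAt (hasMFDerivAt_fst q)
  have h2 := HasMFDerivAt.comp q (Q.mdifferentiable_smul_left a q.2).hasMFDerivAt
    (hasMFDerivAt_snd (I := 𝓘(ℝ, ℝ)) (I' := 𝓡 Q.dim) q)
  exact DFunLike.congr_fun (h1.prodMk h2).mfderiv v

theorem form_translate (t s : ℝ) (a : Q.grp) (q : ℝ × Q.N) (v w : TangentSpace Q.model q) :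
    Q.form t (Q.translate s a q) (mfderiv Q.model Q.model (Q.translate s a) q v)
      (mfderiv Q.model Q.model (Q.translate s a) q w) = Real.exp (t * s) * Q.form t q v w := by
  have h : ∀ (r r' : ℝ) (A B : TangentSpace (𝓡 Q.dim) q.2),
      Real.exp (t * (q.1 + s)) * (r * r' + (r * Q.θ.val (a • q.2)
          (mfderiv (𝓡 Q.dim) (𝓡 Q.dim) (fun z : Q.N ↦ a • z) q.2 B)
        + Q.θ.val (a • q.2) (mfderiv (𝓡 Q.dim) (𝓡 Q.dim) (fun z : Q.N ↦ a • z) q.2 A) * r')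
        + Q.metric.val (a • q.2) (mfderiv (𝓡 Q.dim) (𝓡 Q.dim) (fun z : Q.N ↦ a • z) q.2 A)
          (mfderiv (𝓡 Q.dim) (𝓡 Q.dim) (fun z : Q.N ↦ a • z) q.2 B))
      = Real.exp (t * s) * (Real.exp (t * q.1) *
        (r * r' + (r * Q.θ.val q.2 B + Q.θ.val q.2 A * r') + Q.metric.val q.2 A B)) := by
    intro r r' A B
    rw [Q.isometries, Q.invariant, Q.invariant, mul_add t, Real.exp_add]
    ring
  exact (congrArg₂ (Q.form t (Q.translate s a q)) (mfderiv_translate s a q v)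
    (mfderiv_translate s a q w)).trans (h v.1 w.1 v.2 w.2)

theorem EscapesWithin.translate {t L : ℝ} {p : ℝ × Q.N} (h : Q.EscapesWithin t p L) (s : ℝ)
    (a : Q.grp) : Q.EscapesWithin t (Q.translate s a p) (Real.exp (t * s / 2) * L) := by
  refine h.map (Real.exp_pos _).le (contMDiff_translate s a) (G := Q.translate (-s) a⁻¹)
    (contMDiff_translate _ _).continuous (fun q ↦ ?_) fun q v ↦ ?_
  · simp [QStructure.translate]
  · rw [form_translate, sq, ← Real.exp_add, add_halves]

/-- The group acts by isometries and the shift by `s` is a homothety with factor `e^{ts/2}`. The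
dependence of the escape length on `x` is thus known for any `θ`, without computing that length. -/
theorem escapesWithin_iff {t L : ℝ} (x : ℝ) (y o : Q.N) :
    Q.EscapesWithin t (x, y) L ↔ Q.EscapesWithin t (0, o) (Real.exp (-(t * x / 2)) * L) := by
  obtain ⟨a, rfl⟩ := Q.transitive.exists_smul_eq o y
  constructor <;> intro h
  · have := h.translate (-x) a⁻¹
    rw [QStructure.translate, add_neg_cancel, inv_smul_smul] at this
    convert this using 3
    ring
  · have := h.translate x a
    rw [QStructure.translate, zero_add, ← mul_assoc, ← Real.exp_add, add_neg_cancel, Real.exp_zero,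
      one_mul] at this
    exact this

/-- Follow the `x`-line in the direction in which `e^{tx}` decays. Its length is `∫₀^∞ e^{(tx -
|t|s)/2} ds`, whatever `θ` is. -/
theorem escapesWithin_axis {t : ℝ} (ht : t ≠ 0) (p : ℝ × Q.N) :
    Q.EscapesWithin t p (2 / |t| * Real.exp (t * p.1 / 2)) := by
  obtain ⟨x, y⟩ := p
  obtain ⟨ε, hε, hε1⟩ : ∃ ε : ℝ, ε * t = -|t| ∧ |ε| = 1 := by
    rcases abs_choice t with h | h
    · exact ⟨-1, by rw [h]; ring, by simp⟩
    · exact ⟨1, by rw [h]; ring, by simp⟩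
  have ht' : 0 < |t| := abs_pos.2 ht
  have hder : ∀ s : ℝ, HasDerivAt (fun s : ℝ ↦ x + ε * s) ε s := fun s ↦ by
    simpa using ((hasDerivAt_id s).const_mul ε).const_add x
  refine ⟨fun s ↦ (x + ε * s, y),
    fun s ↦ 2 / |t| * (Real.exp (t * x / 2) - Real.exp (t * (x + ε * s) / 2)),
    fun s ↦ Real.exp (t * (x + ε * s) / 2), ?_, by simp, by simp, fun s h0 ↦ ⟨?_, ?_, ?_, ?_⟩,
    fun K hK ↦ ?_⟩
  · exact ContMDiff.prodMk (contDiff_const.add (contDiff_const.mul contDiff_id)).contMDiff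
      contMDiff_const
  · have h1 := ((((hder s).const_mul t).div_const 2).exp.const_sub
      (Real.exp (t * x / 2))).const_mul (2 / |t|)
    refine h1.congr_deriv ?_
    rw [mul_comm t ε, hε]
    field_simp
  · positivity
  · have : 0 < Real.exp (t * (x + ε * s) / 2) := Real.exp_pos _
    exact mul_le_mul_of_nonneg_left (by linarith) (by positivity)
  · have h1 : HasMFDerivAt 𝓘(ℝ, ℝ) Q.model (fun s ↦ (x + ε * s, y)) s
        (((1 : ℝ →L[ℝ] ℝ).smulRight ε).prod (0 : ℝ →L[ℝ] Eucl Q.dim)) :=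
      HasMFDerivAt.prodMk (hder s).hasFDerivAt.hasMFDerivAt (hasMFDerivAt_const y s)
    rw [h1.mfderiv]
    have h2 : ∀ e : ℝ, e = ε → Real.exp (t * (x + ε * s)) * (e * e
        + (e * Q.θ.val y 0 + Q.θ.val y 0 * e) + Q.metric.val y 0 0)
          ≤ Real.exp (t * (x + ε * s) / 2) ^ 2 := by
      rintro e rfl
      rw [map_zero, map_zero, sq, ← Real.exp_add, add_halves, ← abs_mul_abs_self, hε1]
      simp
    exact h2 _ (one_mul ε)
  · obtain ⟨R, hR⟩ := hK.exists_bound_of_continuousOn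
      (f := fun q : ℝ × Q.N ↦ q.1) continuous_fst.continuousOn
    refine ⟨|x| + |R| + 1, by positivity, fun h ↦ ?_⟩
    have h1 := hR _ h
    rw [Real.norm_eq_abs] at h1
    have h2 : |ε * (|x| + |R| + 1)| = |x| + |R| + 1 := by
      rw [abs_mul, hε1, one_mul, abs_of_pos (by positivity)]
    have h3 := abs_sub_abs_le_abs_sub (ε * (|x| + |R| + 1)) (-x)
    rw [abs_neg, sub_neg_eq_add, add_comm _ x] at h3
    linarith [le_abs_self R]

/-- For `θ = 0` the speed dominates `e^{tx/2} |x'|`, so `e^{tx/2}` changes by at most `|t| L / 2`. A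
smaller `L` would keep it away from `0`, so `x` would be bounded, the projection to `N` would have
finite length, and the curve could not escape. -/
theorem EscapesWithin.le_of_form_eq_zero (hg : ∀ y v, v ≠ 0 → 0 < Q.metric.val y v v)
    (hθ : ∀ y, Q.θ.val y = 0) {t L : ℝ} {p : ℝ × Q.N} (h : Q.EscapesWithin t p L) :
    t ≠ 0 ∧ 2 / |t| * Real.exp (t * p.1 / 2) ≤ L := by
  obtain ⟨γ, ℓ, ℓ', hγ, rfl, hℓ0, hs, hK⟩ := h
  set x : ℝ → ℝ := fun s ↦ (γ s).1 with hx
  set σ : ℝ → Q.N := fun s ↦ (γ s).2 with hσ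
  have hγσ : ∀ s, γ s = (x s, σ s) := fun _ ↦ rfl
  have hxs : ContMDiff 𝓘(ℝ, ℝ) 𝓘(ℝ, ℝ) ∞ x := contMDiff_fst.comp hγ
  have hσs : ContMDiff 𝓘(ℝ, ℝ) (𝓡 Q.dim) ∞ σ := contMDiff_snd.comp hγ
  have hxd : ∀ s, HasDerivAt x (deriv x s) s := fun s ↦
    (hxs.contDiff.differentiable (by simp) s).hasDerivAt
  have hdγ : ∀ s, mfderiv 𝓘(ℝ, ℝ) Q.model γ s (1 : ℝ)
      = (deriv x s, mfderiv 𝓘(ℝ, ℝ) (𝓡 Q.dim) σ s (1 : ℝ)) := by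
    intro s
    have h1 : HasMFDerivAt 𝓘(ℝ, ℝ) Q.model (fun s ↦ (x s, σ s)) s
        (((1 : ℝ →L[ℝ] ℝ).smulRight (deriv x s)).prod (mfderiv 𝓘(ℝ, ℝ) (𝓡 Q.dim) σ s)) :=
      HasMFDerivAt.prodMk (hxd s).hasFDerivAt.hasMFDerivAt
        (hσs.mdifferentiable (by simp) s).hasMFDerivAt
    refine (DFunLike.congr_fun h1.mfderiv (1 : ℝ)).trans ?_
    exact Prod.ext (one_mul (deriv x s)) rfl
  have hnn : ∀ y v, 0 ≤ Q.metric.val y v v := by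
    intro y v
    rcases eq_or_ne v 0 with rfl | hv
    · simp
    · exact (hg y v hv).le
  have hlen : ∀ s, 0 ≤ s → Real.exp (t * x s) * (deriv x s ^ 2 +
      Q.metric.val (σ s) (mfderiv 𝓘(ℝ, ℝ) (𝓡 Q.dim) σ s (1 : ℝ))
        (mfderiv 𝓘(ℝ, ℝ) (𝓡 Q.dim) σ s (1 : ℝ))) ≤ ℓ' s ^ 2 := by
    intro s h0
    have h1 : ∀ (r : ℝ) (A : TangentSpace (𝓡 Q.dim) (σ s)),
        Real.exp (t * x s) * (r ^ 2 + Q.metric.val (σ s) A A)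
          = Real.exp (t * x s) * (r * r + (r * Q.θ.val (σ s) A + Q.θ.val (σ s) A * r)
            + Q.metric.val (σ s) A A) := by
      intro r A
      rw [hθ, zero_apply]
      ring
    rw [h1]
    have h2 := (hs s h0).2.2.2
    rw [hdγ] at h2
    exact h2
  have hx' : ∀ s, 0 ≤ s → |Real.exp (t * x s / 2) * deriv x s| ≤ ℓ' s := by
    intro s h0
    refine abs_le_of_sq_le_sq' ?_ (hs s h0).2.1 |> abs_le.2
    refine le_trans ?_ (hlen s h0)
    rw [mul_pow, sq (Real.exp _), ← Real.exp_add, add_halves]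
    gcongr
    linarith [hnn (σ s) (mfderiv 𝓘(ℝ, ℝ) (𝓡 Q.dim) σ s (1 : ℝ))]
  have hL0 : 0 ≤ L := hℓ0 ▸ (hs 0 le_rfl).2.2.1
  -- if `x` stays bounded, then the curve stays in a compact set
  have hbdd : ∀ R, ¬ ∀ s, 0 ≤ s → |x s| ≤ R := by
    intro R hR
    have hm : ∀ s, 0 ≤ s → Real.exp (-(|t| * R)) ≤ Real.exp (t * x s) := by
      intro s h0
      rw [Real.exp_le_exp]
      have h1 := neg_abs_le (t * x s)
      rw [abs_mul] at h1
      have := mul_le_mul_of_nonneg_left (hR s h0) (abs_nonneg t)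
      linarith
    -- The factor `e^{|t|R/2}` compensates the lower bound `e^{-|t|R}` of the conformal factor on
    -- `|x| ≤ R`.
    obtain ⟨K, hKc, hKσ⟩ := Q.exists_isCompact_of_length_le hg hσs
      (ℓ := fun s ↦ Real.exp (|t| * R / 2) * ℓ s) (ℓ' := fun s ↦ Real.exp (|t| * R / 2) * ℓ' s)
      (L := Real.exp (|t| * R / 2) * L) (fun s h0 ↦ (hs s h0).1.const_mul _)
      (fun s h0 ↦ mul_nonneg (Real.exp_pos _).le (hs s h0).2.1)
      (fun s h0 ↦ mul_le_mul_of_nonneg_left (hs s h0).2.2.1 (Real.exp_pos _).le) (fun s h0 ↦ by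
        have h1 := hnn (σ s) (mfderiv 𝓘(ℝ, ℝ) (𝓡 Q.dim) σ s (1 : ℝ))
        have h2 := hlen s h0
        have h3 := mul_le_mul_of_nonneg_right (hm s h0) h1
        have h4 : Real.exp (|t| * R / 2) ^ 2 * Real.exp (-(|t| * R)) = 1 := by
          rw [sq, ← Real.exp_add, add_halves, ← Real.exp_add, add_neg_cancel, Real.exp_zero]
        have h5 : 0 ≤ Real.exp (t * x s) * deriv x s ^ 2 := by positivity
        calc _ = Real.exp (|t| * R / 2) ^ 2 * (Real.exp (-(|t| * R)) *
              Q.metric.val (σ s) (mfderiv 𝓘(ℝ, ℝ) (𝓡 Q.dim) σ s (1 : ℝ))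
                (mfderiv 𝓘(ℝ, ℝ) (𝓡 Q.dim) σ s (1 : ℝ))) := by rw [← mul_assoc, h4, one_mul]
          _ ≤ Real.exp (|t| * R / 2) ^ 2 * ℓ' s ^ 2 := by
            gcongr
            linarith
          _ = _ := by ring)
    obtain ⟨s, h0, hsK⟩ := hK (Icc (-R) R ×ˢ K) (isCompact_Icc.prod hKc)
    exact hsK ⟨abs_le.1 (hR s h0), hKσ s h0⟩
  -- For `t = 0` the function `x` itself moves by at most `L`, so no curve of finite length escapes.
  rcases eq_or_ne t 0 with rfl | ht
  · refine (hbdd (|x 0| + L) fun s h0 ↦ ?_).elim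
    have h1 := abs_sub_le_of_abs_deriv_le (C := 1) le_rfl h0 (fun s _ ↦ hxd s)
      (fun s h ↦ (hs s h).1) (fun s h ↦ by simpa using hx' s h)
    have h2 := abs_sub_abs_le_abs_sub (x s) (x 0)
    have h3 := (hs s h0).2.2.1
    rw [hℓ0] at h1
    linarith
  refine ⟨ht, not_lt.1 fun hlt ↦ ?_⟩
  have ht' : 0 < |t| := abs_pos.2 ht
  set f : ℝ → ℝ := fun s ↦ Real.exp (t * x s / 2) with hf
  have hfd : ∀ s, HasDerivAt f (t / 2 * (f s * deriv x s)) s := fun s ↦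
    (((hxd s).const_mul t).div_const 2).exp.congr_deriv (by simp only [hf]; ring)
  have hvar : ∀ s, 0 ≤ s → |f s - f 0| ≤ |t| / 2 * L := by
    intro s h0
    have h1 := abs_sub_le_of_abs_deriv_le (C := |t| / 2) le_rfl h0 (fun s _ ↦ hfd s)
      (fun s h ↦ (hs s h).1) (fun s h ↦ by
        rw [abs_mul, abs_div, abs_two]
        exact mul_le_mul_of_nonneg_left (hx' s h) (by positivity))
    refine h1.trans (mul_le_mul_of_nonneg_left ?_ (by positivity))
    rw [hℓ0, sub_zero]
    exact (hs s h0).2.2.1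
  set m := f 0 - |t| / 2 * L with hm
  have hm0 : 0 < m := by
    have h1 : L * |t| < 2 * f 0 := by
      rw [div_mul_eq_mul_div, lt_div_iff₀ ht'] at hlt
      exact hlt
    linarith
  set M := f 0 + |t| / 2 * L with hM
  refine hbdd (2 / |t| * (|Real.log m| + |Real.log M|)) fun s h0 ↦ ?_
  have hv := abs_le.1 (hvar s h0)
  have hfs : 0 < f s := Real.exp_pos _
  have h1 : Real.log m ≤ Real.log (f s) := Real.log_le_log hm0 (by linarith)
  have h2 : Real.log (f s) ≤ Real.log M := Real.log_le_log hfs (by linarith)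
  have h3 : Real.log (f s) = t * x s / 2 := Real.log_exp _
  have h4 : |t * x s / 2| ≤ |Real.log m| + |Real.log M| := by
    rw [← h3, abs_le]
    constructor
    · linarith [neg_abs_le (Real.log m), abs_nonneg (Real.log M)]
    · linarith [le_abs_self (Real.log M), abs_nonneg (Real.log m)]
  rw [abs_div, abs_two, abs_mul, div_le_iff₀ two_pos] at h4
  rw [div_mul_eq_mul_div, le_div_iff₀ ht']
  linarith

end QStructure

/-! ### From an isometry to the Killing equation. -/

namespace QStructure

variable {Q Q' : QStructure.{u, v}} {t t' : ℝ}

theorem form_congr {q q' : ℝ × Q.N} (hq : q = q') (v w : ℝ × Eucl Q.dim) :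
    Q.form t q v w = Q.form t q' v w := by
  subst hq
  rfl

section Diffeo

variable (Φ : (ℝ × Q.N) ≃ₘ^∞⟮Q.model, Q'.model⟯ (ℝ × Q'.N))

theorem mfderiv_diffeomorph_apply_symm (q : ℝ × Q'.N) (v : ℝ × Eucl Q'.dim) :
    (mfderiv Q.model Q'.model Φ (Φ.symm q) (mfderiv Q'.model Q.model Φ.symm q v) :
      ℝ × Eucl Q'.dim) = v := by
  have h1 : HasMFDerivAt Q'.model Q'.model (Φ ∘ Φ.symm) q _ :=
    HasMFDerivAt.comp q (Φ.contMDiff.mdifferentiable (by simp) (Φ.symm q)).hasMFDerivAt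
      (Φ.symm.contMDiff.mdifferentiable (by simp) q).hasMFDerivAt
  have h2 : HasMFDerivAt Q'.model Q'.model (Φ ∘ Φ.symm) q
      (ContinuousLinearMap.id ℝ (ℝ × Eucl Q'.dim)) := by
    have he : Φ ∘ Φ.symm = id := funext Φ.apply_symm_apply
    rw [he]
    exact hasMFDerivAt_id q
  exact DFunLike.congr_fun (hasMFDerivAt_unique h1 h2) v

variable {Φ}
  (hΦ : ∀ p (v w : TangentSpace Q.model p), Q'.form t' (Φ p) (mfderiv Q.model Q'.model Φ p v)
    (mfderiv Q.model Q'.model Φ p w) = Q.form t p v w)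

include hΦ

theorem form_diffeomorph_symm (q : ℝ × Q'.N) (v w : TangentSpace Q'.model q) :
    Q.form t (Φ.symm q) (mfderiv Q'.model Q.model Φ.symm q v)
      (mfderiv Q'.model Q.model Φ.symm q w) = Q'.form t' q v w := by
  rw [← hΦ]
  refine Eq.trans ?_ (form_congr (Φ.apply_symm_apply q) v w)
  exact congrArg₂ (Q'.form t' (Φ (Φ.symm q))) (mfderiv_diffeomorph_apply_symm Φ q v)
    (mfderiv_diffeomorph_apply_symm Φ q w)

/-- The target structure is only pseudo-Riemannian a priori; the completeness argument needs its
metric to be positive definite. -/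
theorem form_pos_of_isometry (hQ : Q.IsRiemannian) (q : ℝ × Q'.N) (v : TangentSpace Q'.model q)
    (hv : v ≠ 0) : 0 < Q'.form t' q v v := by
  rw [← form_diffeomorph_symm hΦ]
  refine hQ t _ _ fun h ↦ hv ?_
  have h1 := mfderiv_diffeomorph_apply_symm Φ q v
  rw [h] at h1
  exact h1.symm.trans (map_zero (mfderiv Q.model Q'.model Φ (Φ.symm q)))

theorem escapesWithin_isometry_iff (p : ℝ × Q.N) (L : ℝ) :
    Q.EscapesWithin t p L ↔ Q'.EscapesWithin t' (Φ p) L := by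
  constructor <;> intro h
  · have := h.map zero_le_one Φ.contMDiff Φ.symm.continuous Φ.symm_apply_apply
      (t' := t') fun p v ↦ by rw [hΦ, one_pow, one_mul]
    rwa [one_mul] at this
  · have := h.map zero_le_one Φ.symm.contMDiff Φ.continuous Φ.apply_symm_apply
      (t' := t) fun p v ↦ by rw [form_diffeomorph_symm hΦ, one_pow, one_mul]
    rwa [one_mul, Φ.symm_apply_apply] at this

/-- An isometry to a product metric maps slices to slices. -/
theorem height_isometry (hQ : Q.IsRiemannian) (hθ : ∀ y, Q'.θ.val y = 0) (ht : t ≠ 0) :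
    t' ≠ 0 ∧ ∀ (x : ℝ) (y o : Q.N), t' * (Φ (x, y)).1 = t * x + t' * (Φ (0, o)).1 := by
  have hg' : ∀ y v, v ≠ 0 → 0 < Q'.metric.val y v v := by
    intro y v hv
    have h := form_pos_of_isometry hΦ hQ (0, y) ((0 : ℝ), v) fun h ↦ hv (congr_arg Prod.snd h)
    have h1 : Q'.form t' (0, y) ((0 : ℝ), v) ((0 : ℝ), v) = Real.exp (t' * 0) * (0 * 0
      + (0 * Q'.θ.val y v + Q'.θ.val y v * 0) + Q'.metric.val y v v) := rfl
    rw [h1] at h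
    simpa using h
  have ht' : t' ≠ 0 := by
    obtain ⟨o⟩ := (inferInstance : Nonempty Q.N)
    exact (((escapesWithin_isometry_iff hΦ _ _).1
      (escapesWithin_axis ht (0, o))).le_of_form_eq_zero hg' hθ).1
  refine ⟨ht', fun x y o ↦ ?_⟩
  -- Upper and lower bound in the target coincide, so the escape length at `p` is exactly a function
  -- of the height of `Φ p`.
  have hE : ∀ p L, Q.EscapesWithin t p L ↔ 2 / |t'| * Real.exp (t' * (Φ p).1 / 2) ≤ L :=
    fun p L ↦ (escapesWithin_isometry_iff hΦ p L).trans
      ⟨fun h ↦ (h.le_of_form_eq_zero hg' hθ).2, fun h ↦ (escapesWithin_axis ht' _).mono h⟩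
  have h1 : ∀ L, 2 / |t'| * Real.exp (t' * (Φ (x, y)).1 / 2) ≤ L ↔
      2 / |t'| * Real.exp ((t * x + t' * (Φ (0, o)).1) / 2) ≤ L := by
    intro L
    rw [← hE, escapesWithin_iff x y o, hE, ← mul_le_mul_iff_right₀ (Real.exp_pos (t * x / 2)),
      ← mul_assoc (Real.exp (t * x / 2)) _ L, ← Real.exp_add, add_neg_cancel, Real.exp_zero,
      one_mul, mul_left_comm, ← Real.exp_add, ← add_div]
  have h2 : 2 / |t'| * Real.exp (t' * (Φ (x, y)).1 / 2)
      = 2 / |t'| * Real.exp ((t * x + t' * (Φ (0, o)).1) / 2) :=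
    le_antisymm ((h1 _).2 le_rfl) ((h1 _).1 le_rfl)
  have h3 : 2 / |t'| ≠ 0 := (div_pos two_pos (abs_pos.2 ht')).ne'
  have h4 := Real.exp_injective (mul_left_cancel₀ h3 h2)
  linarith

/-- The `x`-lines of the target meet the slices orthogonally. Transported by `Φ⁻¹`, they become
curves `s ↦ (k s, ψ_s y)`; comparing metrics along the slices and on the velocities determines
`ψ_s^* g_N` and the initial velocity of `ψ`. -/
theorem isKilling_of_isometry (hQ : Q.IsRiemannian) (hθ : ∀ y, Q'.θ.val y = 0) (ht : t ≠ 0) :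
    Q.θ.IsKilling Q.metric := by
  obtain ⟨o⟩ := (inferInstance : Nonempty Q.N)
  obtain ⟨ht', hheight⟩ := height_isometry hΦ hQ hθ ht
  set a₀ := (Φ (0, o)).1 with ha₀
  -- By `height_isometry`, raising the target height by `s` raises `x` by `k s`.
  set k := t' / t with hk
  have hk0 : k ≠ 0 := div_ne_zero ht' ht
  have htk : t * k = t' := by rw [hk]; field_simp
  set B : Q.N → Q'.N := fun y ↦ (Φ (0, y)).2 with hB
  have hΦ0 : ∀ y, Φ (0, y) = (a₀, B y) := fun y ↦ by
    refine Prod.ext (mul_left_cancel₀ ht' ?_) rfl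
    rw [hheight 0 y o, mul_zero, zero_add]
  have hBs : ContMDiff (𝓡 Q.dim) (𝓡 Q'.dim) ∞ B :=
    contMDiff_snd.comp (Φ.contMDiff.comp (contMDiff_const.prodMk contMDiff_id))
  set ψ : ℝ × Q.N → Q.N := fun q ↦ (Φ.symm (a₀ + q.1, B q.2)).2 with hψ
  have hψs : ContMDiff (𝓘(ℝ, ℝ).prod (𝓡 Q.dim)) (𝓡 Q.dim) ∞ ψ := by
    refine contMDiff_snd.comp (Φ.symm.contMDiff.comp (ContMDiff.prodMk ?_
      (hBs.comp contMDiff_snd)))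
    exact ContMDiff.comp (g := fun s : ℝ ↦ a₀ + s) (contDiff_const.add contDiff_id).contMDiff
      contMDiff_fst
  have hΦψ : ∀ s y, Φ (k * s, ψ (s, y)) = (a₀ + s, B y) := by
    intro s y
    have h1 : (k * s, ψ (s, y)) = Φ.symm (a₀ + s, B y) := by
      refine Prod.ext (mul_left_cancel₀ ht ?_) rfl
      have h2 := hheight (Φ.symm (a₀ + s, B y)).1 (Φ.symm (a₀ + s, B y)).2 o
      rw [Prod.mk.eta, Φ.apply_symm_apply] at h2
      rw [← mul_assoc, htk]
      linarith
    rw [h1, Φ.apply_symm_apply]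
  have hψ0 : ∀ y, ψ (0, y) = y := fun y ↦ by
    have h1 := hΦψ 0 y
    rw [mul_zero, add_zero, ← hΦ0] at h1
    exact congr_arg Prod.snd (Φ.injective h1)
  have hψl : ∀ s, MDifferentiable (𝓡 Q.dim) (𝓡 Q.dim) (fun y ↦ ψ (s, y)) := fun s ↦
    (hψs.comp (contMDiff_const.prodMk contMDiff_id)).mdifferentiable (by simp)
  have hψr : ∀ y, MDifferentiable 𝓘(ℝ, ℝ) (𝓡 Q.dim) (fun s : ℝ ↦ ψ (s, y)) := fun y ↦
    (hψs.comp (contMDiff_id.prodMk contMDiff_const)).mdifferentiable (by simp)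
  have hΦd := Φ.contMDiff.mdifferentiable (by simp)
  -- the differential of `Φ` on vectors tangent to a slice, and on the velocity of `ψ`
  have hslice : ∀ s y (v : TangentSpace (𝓡 Q.dim) y),
      (mfderiv Q.model Q'.model Φ (k * s, ψ (s, y))
        ((0 : ℝ), mfderiv (𝓡 Q.dim) (𝓡 Q.dim) (fun y ↦ ψ (s, y)) y v) : ℝ × Eucl Q'.dim)
        = ((0 : ℝ), mfderiv (𝓡 Q.dim) (𝓡 Q'.dim) B y v) := by
    intro s y v
    have h1 : HasMFDerivAt (𝓡 Q.dim) Q.model (fun y ↦ (k * s, ψ (s, y))) y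
        ((0 : Eucl Q.dim →L[ℝ] ℝ).prod (mfderiv (𝓡 Q.dim) (𝓡 Q.dim) (fun y ↦ ψ (s, y)) y)) :=
      HasMFDerivAt.prodMk (hasMFDerivAt_const (k * s) y) (hψl s y).hasMFDerivAt
    have h2 : HasMFDerivAt (𝓡 Q.dim) Q'.model (Φ ∘ fun y ↦ (k * s, ψ (s, y))) y _ :=
      HasMFDerivAt.comp (f := fun y ↦ (k * s, ψ (s, y))) y (hΦd _).hasMFDerivAt h1
    have h3 : HasMFDerivAt (𝓡 Q.dim) Q'.model (Φ ∘ fun y ↦ (k * s, ψ (s, y))) y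
        ((0 : Eucl Q.dim →L[ℝ] ℝ).prod (mfderiv (𝓡 Q.dim) (𝓡 Q'.dim) B y :
          Eucl Q.dim →L[ℝ] Eucl Q'.dim)) := by
      have he : (Φ ∘ fun y ↦ (k * s, ψ (s, y))) = fun y ↦ (a₀ + s, B y) := funext (hΦψ s)
      rw [he]
      exact HasMFDerivAt.prodMk (hasMFDerivAt_const (a₀ + s) y)
        (hBs.mdifferentiable (by simp) y).hasMFDerivAt
    exact DFunLike.congr_fun (hasMFDerivAt_unique h2 h3) v
  have hvel : ∀ y, (mfderiv Q.model Q'.model Φ (k * 0, ψ (0, y))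
        (k, mfderiv 𝓘(ℝ, ℝ) (𝓡 Q.dim) (fun s : ℝ ↦ ψ (s, y)) 0 (1 : ℝ)) : ℝ × Eucl Q'.dim)
        = ((1 : ℝ), (0 : Eucl Q'.dim)) := by
    intro y
    have h1 : HasMFDerivAt 𝓘(ℝ, ℝ) Q.model (fun s : ℝ ↦ (k * s, ψ (s, y))) 0
        ((k • ContinuousLinearMap.id ℝ ℝ).prod
          (mfderiv 𝓘(ℝ, ℝ) (𝓡 Q.dim) (fun s : ℝ ↦ ψ (s, y)) 0)) :=
      HasMFDerivAt.prodMk ((hasFDerivAt_id (0 : ℝ)).const_mul k).hasMFDerivAt (hψr y 0).hasMFDerivAt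
    have h2 : HasMFDerivAt 𝓘(ℝ, ℝ) Q'.model (Φ ∘ fun s : ℝ ↦ (k * s, ψ (s, y))) 0 _ :=
      HasMFDerivAt.comp (f := fun s : ℝ ↦ (k * s, ψ (s, y))) (0 : ℝ) (hΦd _).hasMFDerivAt h1
    have h3 : HasMFDerivAt 𝓘(ℝ, ℝ) Q'.model (Φ ∘ fun s : ℝ ↦ (k * s, ψ (s, y))) 0
        ((ContinuousLinearMap.id ℝ ℝ).prod (0 : ℝ →L[ℝ] Eucl Q'.dim)) := by
      have he : (Φ ∘ fun s : ℝ ↦ (k * s, ψ (s, y))) = fun s ↦ (a₀ + s, B y) :=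
        funext fun s ↦ hΦψ s y
      rw [he]
      exact HasMFDerivAt.prodMk ((hasFDerivAt_id (0 : ℝ)).const_add a₀).hasMFDerivAt
        (hasMFDerivAt_const (B y) (0 : ℝ))
    have h4 := DFunLike.congr_fun (hasMFDerivAt_unique h2 h3) (1 : ℝ)
    refine Eq.trans ?_ h4
    exact congrArg (mfderiv Q.model Q'.model Φ (k * 0, ψ (0, y)))
      (Prod.ext (mul_one k).symm rfl)
  have hform : ∀ s y (V W : TangentSpace Q.model (k * s, ψ (s, y))) (V' W' : ℝ × Eucl Q'.dim),
      (mfderiv Q.model Q'.model Φ (k * s, ψ (s, y)) V : ℝ × Eucl Q'.dim) = V' →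
      (mfderiv Q.model Q'.model Φ (k * s, ψ (s, y)) W : ℝ × Eucl Q'.dim) = W' →
      Q.form t (k * s, ψ (s, y)) V W = Q'.form t' (a₀ + s, B y) V' W' := by
    rintro s y V W _ _ rfl rfl
    rw [← hΦ]
    exact form_congr (hΦψ s y) _ _
  -- On slices the isometry reads `e^{tks} ψ_s^* g_N = e^{t'(a₀ + s)} B^* g_{N'}`. As `t k = t'`,
  -- the factors depending on `s` cancel.
  have hψiso : ∀ s y (v w : TangentSpace (𝓡 Q.dim) y),
      Q.metric.val (ψ (s, y)) (mfderiv (𝓡 Q.dim) (𝓡 Q.dim) (fun y ↦ ψ (s, y)) y v)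
        (mfderiv (𝓡 Q.dim) (𝓡 Q.dim) (fun y ↦ ψ (s, y)) y w)
      = Real.exp (t' * a₀) * Q'.metric.val (B y) (mfderiv (𝓡 Q.dim) (𝓡 Q'.dim) B y v)
        (mfderiv (𝓡 Q.dim) (𝓡 Q'.dim) B y w) := by
    intro s y v w
    have h := hform s y _ _ _ _ (hslice s y v) (hslice s y w)
    have h1 : ∀ A A', Q.form t (k * s, ψ (s, y)) ((0 : ℝ), A) ((0 : ℝ), A')
      = Real.exp (t * (k * s)) * (0 * 0 + (0 * Q.θ.val (ψ (s, y)) A'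
        + Q.θ.val (ψ (s, y)) A * 0) + Q.metric.val (ψ (s, y)) A A') := fun _ _ ↦ rfl
    have h2 : ∀ A A', Q'.form t' (a₀ + s, B y) ((0 : ℝ), A) ((0 : ℝ), A')
      = Real.exp (t' * (a₀ + s)) * (0 * 0 + (0 * Q'.θ.val (B y) A'
        + Q'.θ.val (B y) A * 0) + Q'.metric.val (B y) A A') := fun _ _ ↦ rfl
    replace h := (h1 _ _).symm.trans (h.trans (h2 _ _))
    rw [← mul_assoc, htk, mul_add t', Real.exp_add, mul_comm (Real.exp (t' * a₀)),
      mul_assoc] at h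
    have h3 := mul_left_cancel₀ (Real.exp_pos (t' * s)).ne' h
    linarith
  -- Orthogonality of the velocity `(k, ψ')` to slice vectors `(0, w)` reads `k θ(w) + g(ψ', w) =
  -- 0`.
  have hψvel : ∀ y (w : TangentSpace (𝓡 Q.dim) (ψ (0, y))), Q.metric.val (ψ (0, y))
      (mfderiv 𝓘(ℝ, ℝ) (𝓡 Q.dim) (fun s : ℝ ↦ ψ (s, y)) 0 (1 : ℝ)) w
        = -k * Q.θ.val (ψ (0, y)) w := by
    intro y w
    obtain ⟨w, rfl⟩ : ∃ w' : TangentSpace (𝓡 Q.dim) y,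
        mfderiv (𝓡 Q.dim) (𝓡 Q.dim) (fun y ↦ ψ (0, y)) y w' = w := by
      have h1 : HasMFDerivAt (𝓡 Q.dim) (𝓡 Q.dim) (fun y ↦ ψ (0, y)) y
          (ContinuousLinearMap.id ℝ (Eucl Q.dim)) := by
        have he : (fun y ↦ ψ (0, y)) = id := funext hψ0
        rw [he]
        exact hasMFDerivAt_id y
      exact ⟨w, DFunLike.congr_fun h1.mfderiv w⟩
    have h := hform 0 y _ _ _ _ (hvel y) (hslice 0 y w)
    have h1 : ∀ A A', Q.form t (k * 0, ψ (0, y)) (k, A) ((0 : ℝ), A')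
      = Real.exp (t * (k * 0)) * (k * 0 + (k * Q.θ.val (ψ (0, y)) A'
        + Q.θ.val (ψ (0, y)) A * 0) + Q.metric.val (ψ (0, y)) A A') := fun _ _ ↦ rfl
    have h2 : ∀ A', Q'.form t' (a₀ + 0, B y) ((1 : ℝ), (0 : Eucl Q'.dim)) ((0 : ℝ), A')
      = Real.exp (t' * (a₀ + 0)) * (1 * 0 + (1 * Q'.θ.val (B y) A'
        + Q'.θ.val (B y) 0 * 0) + Q'.metric.val (B y) 0 A') := fun _ ↦ rfl
    replace h := (h1 _ _).symm.trans (h.trans (h2 _))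
    have h3 : ∀ A', Q'.metric.val (B y) 0 A' = 0 := fun A' ↦ by rw [map_zero]; rfl
    rw [hθ, zero_apply, zero_apply, h3, mul_zero k, mul_zero t, Real.exp_zero] at h
    linarith
  intro p u hu a b
  have h1 := hasDerivAt_pullback_metric Q.metric Q.θ hψs hψ0 hψvel p hu a b
  simp only [hψiso] at h1
  -- The same derivative is `-k (θ_{a;b} + θ_{b;a})` by the first variation formula and `0` because
  -- the pullback is constant in `s`.
  exact (mul_eq_zero.1 (h1.unique (hasDerivAt_const _ _))).resolve_left (neg_ne_zero.2 hk0)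

end Diffeo

end QStructure

end

theorem theorem1 (Q : QStructure.{u, v}) (hQ : Q.IsRiemannian) (t : ℝ) :
    (t ≠ 0 →
      ((∃ (t' : ℝ) (Q' : QStructure.{u, v}), (∀ y : Q'.N, Q'.θ.val y = 0) ∧ Q.Isometric t Q' t') ↔
        Q.θ.IsKilling Q.metric)) ∧
    (Q.θ.IsKilling Q.metric →
      ∃ (t' : ℝ) (Q' : QStructure.{u, v}),
        (∀ y : Q'.N, Q'.θ.val y = 0) ∧ Q.Isometric t Q' t') := by
  have h (hK : Q.θ.IsKilling Q.metric) := Q.exists_isometric_of_isKilling hQ hK t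
  exact ⟨fun ht ↦ ⟨fun ⟨_, _, hθ, _, hΦ⟩ ↦ QStructure.isKilling_of_isometry hΦ hQ hθ ht, h⟩, h⟩
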